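/- Let $\mathbb F$ be an algebraically closed field of characteristic not $2$. For a graph $\Gamma$ with vertices $1,\dots,n$ ($n\ge 1$) let $\mathcal F_\Gamma$ be the quotient of the free Lie algebra over $\mathbb F$ on $x_1,\dots,x_n$ by the ideal generated by all $[x_i,x_j]$ with $\{i,j\}$ not an edge of $\Gamma$. For a tuple $\mathfrak f=(\mathfrak f_1,\dots,\mathfrak f_n)\in(\mathcal F_\Gamma^*)^n$ of linear functionals let $\mathcal L_\Gamma(\mathfrak f)$ be the quotient of $\mathcal F_\Gamma$ by the ideal generated by all $[x_i,[x_i,y]]-\mathfrak f_i(y)x_i$ with $y\in\mathcal F_\Gamma$, $1\le i\le n$, and let $X_\Gamma=\{\mathfrak f : \dim \mathcal L_\Gamma(\mathfrak f)=\dim\mathcal L_\Gamma(0)\}$. Products of generators are right-normed brackets, $x_ax_b\cdots x_yx_z=[x_a,[x_b,\dots,[x_y,x_z]\dots]]$, and $w=x_3x_4\cdots x_{n-2}\,x_nx_{n-1}\cdots x_2$. An element $x\neq 0$ of a Lie algebra $\mathcal L$ over $\mathbb F$ is extremal if $[x,[x,\mathcal L]]\subseteq\mathbb Fx$. An extremal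 form on $\mathcal L$ is a symmetric bilinear form $f$ with $f(x,[y,z])=f([x,y],z)$ for all $x,y,z\in\mathcal L$ and $[x,[x,y]]=f(x,y)x$ for all extremal $x$ and all $y\in\mathcal L$. Let $\Gamma_{C;n}$ be the path $1-2-\cdots-n$; let $\Gamma_{A;n}$ be this path with the extra edge $\{1,3\}$; let $\Gamma_{D;n}$ be this path with the extra edges $\{1,3\}$ and $\{n-2,n\}$; and let $\Gamma_{B;n}$ be $\Gamma_{D;n}$ without the edge $\{n-1,n\}$. Then the following maps are injective: (D) for $n\ge5$, $\psi_D\colon X_{\Gamma_{D;n}}\to\mathbb F^{n+4}$, $\mathfrak f\mapsto(\mathfrak f_1(x_2),\mathfrak f_2(x_3),\dots,\mathfrak f_{n-1}(x_n);\ \mathfrak f_1(x_3),\mathfrak f_1(x_2x_3),\mathfrak f_{n-2}(x_n),\mathfrak f_{n-2}(x_{n-1}x_n),\mathfrak f_1(w))$; (B) for $n\ge5$, $\psi_B\colon X_{\Gamma_{B;n}}\to\mathbb F^{n+2}$, $\mathfrak f\mapsto(\mathfrak f_1(x_2),\mathfrak f_2(x_3),\dots,\mathfrak f_{n-2}(x_{n-1});\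 \mathfrak f_1(x_3),\mathfrak f_1(x_2x_3),\mathfrak f_{n-2}(x_n),\mathfrak f_1(w))$; (A) for $n\ge3$, $\psi_A\colon X_{\Gamma_{A;n}}\to\mathbb F^{n+1}$, $\mathfrak f\mapsto(\mathfrak f_1(x_2),\mathfrak f_2(x_3),\dots,\mathfrak f_{n-1}(x_n);\ \mathfrak f_1(x_3),\mathfrak f_1(x_2x_3))$; (C) for $n\ge1$, $\psi_C\colon X_{\Gamma_{C;n}}\to\mathbb F^{n-1}$, $\mathfrak f\mapsto(\mathfrak f_1(x_2),\mathfrak f_2(x_3),\dots,\mathfrak f_{n-1}(x_n))$. Moreover, in each case these values determine the whole extremal form: if $\psi(\mathfrak f)=\psi(\mathfrak f')$ with $\mathfrak f,\mathfrak f'\in X_\Gamma$, and $f$, $f'$ are extremal forms on $\mathcal L_\Gamma(\mathfrak f)$ and $\mathcal L_\Gamma(\mathfrak f')$, then $f(\bar u,\bar v)=f'(\bar u,\bar v)$ for all $u,v\in\mathcal F_\Gamma$, where the bars denote the images in the respective quotients. -/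

import Mathlib

noncomputable section

namespace ExtremalLie

/-! ### Extremal elements and extremal forms -/

/-- A nonzero element `x` of a Lie algebra is extremal if `[x, [x, y]]` is a multiple of `x` for
every `y`. -/
def IsExtremal (F : Type*) {L : Type*} [Field F] [LieRing L] [LieAlgebra F L] (x : L) : Prop :=
  x ≠ 0 ∧ ∀ y : L, ∃ c : F, ⁅x, ⁅x, y⁆⁆ = c • x

/-- The extremal form: the symmetric associative bilinear form `β` with `[x, [x, y]] = β x y • x`
for all extremal `x`. -/
def IsExtremalForm {F L : Type*} [Field F] [LieRing L] [LieAlgebra F L]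
    (β : LinearMap.BilinForm F L) : Prop :=
  (∀ x : L, IsExtremal F x → ∀ y : L, ⁅x, ⁅x, y⁆⁆ = β x y • x) ∧
  (∀ x y z : L, β x ⁅y, z⁆ = β ⁅x, y⁆ z) ∧
  (∀ x y : L, β x y = β y x)

/-! ### The Lie algebras attached to a graph -/

section Framework

variable (F : Type*) [Field F] {V : Type*} (Γ : SimpleGraph V)

/-- The ideal of the free Lie algebra generated by the `[x_i, x_j]` with `{i, j}` not an edge. -/
def commIdeal : LieIdeal F (FreeLieAlgebra F V) :=
  LieSubmodule.lieSpan F (FreeLieAlgebra F V)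
    {z | ∃ i j : V, ¬ Γ.Adj i j ∧ z = ⁅FreeLieAlgebra.of F i, FreeLieAlgebra.of F j⁆}

/-- The free Lie algebra on the vertices, modulo commutation of nonadjacent vertices. -/
abbrev GraphLie : Type _ := FreeLieAlgebra F V ⧸ commIdeal F Γ

/-- The standard generator `x_i`. -/
def gen (i : V) : GraphLie F Γ :=
  LieSubmodule.Quotient.mk (FreeLieAlgebra.of F i)

/-- The right-normed monomial `x_{i₁} x_{i₂} ⋯ x_{iₖ} = [x_{i₁}, [x_{i₂}, [⋯, x_{iₖ}]]]`; the empty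
word gets the value `0`. -/
def mono : List V → GraphLie F Γ
  | [] => 0
  | [i] => gen F Γ i
  | i :: j :: w => ⁅gen F Γ i, mono (j :: w)⁆

/-- Families `(f_i)` of linear functionals, one for each vertex. -/
abbrev Functionals : Type _ := V → Module.Dual F (GraphLie F Γ)

variable {F Γ}

/-- The ideal generated by all `[x_i, [x_i, y]] - f_i(y) x_i`. -/
def extIdeal (f : Functionals F Γ) : LieIdeal F (GraphLie F Γ) :=
  LieSubmodule.lieSpan F (GraphLie F Γ)
    {z | ∃ (i : V) (y : GraphLie F Γ),
      z = ⁅gen F Γ i, ⁅gen F Γ i, y⁆⁆ - f i y • gen F Γ i}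

/-- The Lie algebra with prescribed extremal functionals. -/
abbrev ExtLie (f : Functionals F Γ) : Type _ := GraphLie F Γ ⧸ extIdeal f

/-- The natural projection. -/
def proj (f : Functionals F Γ) (u : GraphLie F Γ) : ExtLie f :=
  LieSubmodule.Quotient.mk u

variable (F Γ)

/-- The parameter space: the `f` for which the algebra has the same dimension as the one for
`f = 0` (that is, the number of monomials in a monomial basis of the latter). -/
def ParamSpace : Set (Functionals F Γ) :=
  {f | Module.rank F (ExtLie f) = Module.rank F (ExtLie (0 : Functionals F Γ))}

variable {F Γ}

/-- The value of `ψ` at a point of the parameter space determines the value of the extremal form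
at the images of any two elements of `GraphLie F Γ`. -/
def DeterminesForm {T : Type*} (ψ : ParamSpace F Γ → T) : Prop :=
  ∀ f f' : ParamSpace F Γ, ψ f = ψ f' →
    ∀ (β : LinearMap.BilinForm F (ExtLie f.1)) (β' : LinearMap.BilinForm F (ExtLie f'.1)),
      IsExtremalForm β → IsExtremalForm β' →
        ∀ u v : GraphLie F Γ, β (proj f.1 u) (proj f.1 v) = β' (proj f'.1 u) (proj f'.1 v)

end Framework

/-! ### The four graphs on the vertices `1, …, n` -/

/-- The label in `{1, …, n}` of an element of `Fin n`. -/
def label {n : ℕ} (i : Fin n) : ℕ := i.1 + 1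

/-- The path `1 - 2 - ⋯ - n`. -/
def graphC (n : ℕ) : SimpleGraph (Fin n) :=
  SimpleGraph.fromRel fun i j => label i + 1 = label j

/-- The path `1 - 2 - ⋯ - n` with the extra edge `{1, 3}`. -/
def graphA (n : ℕ) : SimpleGraph (Fin n) :=
  SimpleGraph.fromRel fun i j =>
    label i + 1 = label j ∨ (label i = 1 ∧ label j = 3)

/-- The path `1 - 2 - ⋯ - (n-1)` with the extra edges `{1, 3}` and `{n-2, n}`. -/
def graphB (n : ℕ) : SimpleGraph (Fin n) :=
  SimpleGraph.fromRel fun i j =>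
    (label i + 1 = label j ∧ label j < n) ∨ (label i = 1 ∧ label j = 3) ∨
      (label i + 2 = n ∧ label j = n)

/-- The path `1 - 2 - ⋯ - n` with the extra edges `{1, 3}` and `{n-2, n}`. -/
def graphD (n : ℕ) : SimpleGraph (Fin n) :=
  SimpleGraph.fromRel fun i j =>
    label i + 1 = label j ∨ (label i = 1 ∧ label j = 3) ∨
      (label i + 2 = n ∧ label j = n)

section Parameters

variable {F : Type*} [Field F] {n : ℕ} [NeZero n]

/-- The element of `Fin n` with label `k`, for `1 ≤ k ≤ n`. -/
def vert (n : ℕ) [NeZero n] (k : ℕ) : Fin n := Fin.ofNat n (k - 1)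

/-- The value `f_k(x_{w₁} x_{w₂} ⋯)` for a label `k` and a word `w` in the labels. -/
def val {Γ : SimpleGraph (Fin n)} (f : Functionals F Γ) (k : ℕ) (w : List ℕ) : F :=
  f (vert n k) (mono F Γ (w.map (vert n)))

/-- The labels `a, a + 1, …, b`. -/
def up (a b : ℕ) : List ℕ := List.range' a (b + 1 - a)

/-- The labels `b, b - 1, …, a`. -/
def down (b a : ℕ) : List ℕ := (up a b).reverse

/-- `(f_1(x_2), …, f_{n-1}(x_n))`. -/
def psiC (f : ParamSpace F (graphC n)) : Fin (n - 1) → F :=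
  fun i => val f.1 (i + 1) [i + 2]

/-- `(f_1(x_2), …, f_{n-1}(x_n); f_1(x_3), f_1(x_2 x_3))`. -/
def psiA (hn : 3 ≤ n) (f : ParamSpace F (graphA n)) : Fin (n + 1) → F :=
  Fin.append (m := n - 1) (n := 2)
    (fun i => val f.1 (i + 1) [i + 2])
    ![val f.1 1 [3], val f.1 1 [2, 3]] ∘ Fin.cast (by omega)

/-- `(f_1(x_2), …, f_{n-2}(x_{n-1}); f_1(x_3), f_1(x_2 x_3), f_{n-2}(x_n),
f_1(x_3 ⋯ x_{n-2} x_n x_{n-1} ⋯ x_2))`. -/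
def psiB (hn : 5 ≤ n) (f : ParamSpace F (graphB n)) : Fin (n + 2) → F :=
  Fin.append (m := n - 2) (n := 4)
    (fun i => val f.1 (i + 1) [i + 2])
    ![val f.1 1 [3], val f.1 1 [2, 3], val f.1 (n - 2) [n],
      val f.1 1 (up 3 (n - 2) ++ down n 2)] ∘ Fin.cast (by omega)

/-- `(f_1(x_2), …, f_{n-1}(x_n); f_1(x_3), f_1(x_2 x_3), f_{n-2}(x_n), f_{n-2}(x_{n-1} x_n),
f_1(x_3 ⋯ x_{n-2} x_n x_{n-1} ⋯ x_2))`. -/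
def psiD (hn : 5 ≤ n) (f : ParamSpace F (graphD n)) : Fin (n + 4) → F :=
  Fin.append (m := n - 1) (n := 5)
    (fun i => val f.1 (i + 1) [i + 2])
    ![val f.1 1 [3], val f.1 1 [2, 3], val f.1 (n - 2) [n], val f.1 (n - 2) [n - 1, n],
      val f.1 1 (up 3 (n - 2) ++ down n 2)] ∘ Fin.cast (by omega)

end Parameters

end ExtremalLie

end

noncomputable section
namespace ExtremalLie

/-! ### Generators, sandwiches and invariant forms -/

section General

variable {F L : Type*} [Field F] [LieRing L] [LieAlgebra F L]

/-! The proof turns a nonlinear question about `f` into a linear one about invariant forms on the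
algebra for `f = 0`.

Suppose the generators are nonzero in `ExtLie f`. Being extremal, they force the whole algebra to be
spanned by extremal elements (apply exponentials, characteristic not 2), and this yields an extremal
form (`exists_isExtremalForm`). Its pullback `B` to the graph algebra satisfies `B(x_i, y) = f_i(y)`
and `B([x_i,[x_i,y]], v) = B(x_i, y) B(x_i, v)`. Take two parameters with pullbacks `B`, `B'` that
agree in total degree below `d`. The right-hand side of the second identity involves only smaller
degrees, so the degree `d` component of `B - B'` has every `[x_i,[x_i,y]]` in its radical and
descends to an invariant form on the algebra for `f = 0`. If such a form is determined by the listed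
values, it vanishes, and induction on `d` gives `B = B'`, hence `f = f'` (`functionals_eq`).

Membership in the parameter space serves to keep the generators nonzero: homogeneous elements that
give a basis for `f = 0` span for every `f`, and equal finite dimension makes them a basis again
(`projHom_gen_ne_zero`).

For `f = 0` the generators are sandwiches. Numbering them from the far end, `z_j = x_{m+5-j}`, and
putting zeros for missing labels makes all four graphs instances of one pattern, a path with a
triangle at either end (`IsSandwichFamily`). A word operator can be reduced so that its top letter
occurs at most once, except for the palindrome-like operator `bounce`, which all its letters kill
from both sides (`ad_mul_mul_ad`). This gives finite dimension and an explicit spanning set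
(`sup_eq_top`). Pairing that set with the generators leaves only pairs of generators, the two
triangles and the long word `w` (`form_eq_zero`).

The extremal form is then determined too: equal values give the same `f`, and two extremal forms on
one algebra generated by extremal elements coincide. -/

/-- A subspace that contains a set and is stable under bracketing with its elements contains the
Lie subalgebra generated by the set. -/
theorem lieSpan_le_submodule {s : Set L} (S : Submodule F L) (hmem : ∀ x ∈ s, x ∈ S)
    (hlie : ∀ x ∈ s, ∀ y ∈ S, ⁅x, y⁆ ∈ S) {u : L} (hu : u ∈ LieSubalgebra.lieSpan F L s) :
    u ∈ S := by
  -- The elements of `S` that bracket `S` into itself are closed under brackets, by Jacobi.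
  let K : LieSubalgebra F L :=
    { carrier := {u | u ∈ S ∧ ∀ y ∈ S, ⁅u, y⁆ ∈ S}
      add_mem' := fun {u v} hu hv =>
        ⟨S.add_mem hu.1 hv.1, fun y hy => by
          rw [add_lie]; exact S.add_mem (hu.2 y hy) (hv.2 y hy)⟩
      zero_mem' := ⟨S.zero_mem, fun y _ => by rw [zero_lie]; exact S.zero_mem⟩
      smul_mem' := fun c u hu =>
        ⟨S.smul_mem c hu.1, fun y hy => by rw [smul_lie]; exact S.smul_mem c (hu.2 y hy)⟩
      lie_mem' := fun {u v} hu hv =>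
        ⟨hu.2 v hv.1, fun y hy => by
          rw [lie_lie]
          exact S.sub_mem (hu.2 _ (hv.2 y hy)) (hv.2 _ (hu.2 y hy))⟩ }
  have hK : LieSubalgebra.lieSpan F L s ≤ K :=
    LieSubalgebra.lieSpan_le.2 fun x hx => ⟨hmem x hx, hlie x hx⟩
  exact (hK hu).1

/-- A subspace that contains generators of a Lie algebra and is stable under bracketing with them
is everything. -/
theorem submodule_eq_top_of_lieSpan_eq_top {s : Set L} (hs : LieSubalgebra.lieSpan F L s = ⊤)
    (S : Submodule F L) (hmem : ∀ x ∈ s, x ∈ S) (hlie : ∀ x ∈ s, ∀ y ∈ S, ⁅x, y⁆ ∈ S) :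
    S = ⊤ := by
  rw [eq_top_iff]
  intro u _
  exact lieSpan_le_submodule S hmem hlie (hs ▸ LieSubalgebra.mem_top u)

/-- If `(ad x)² = 0`, then also `ad x ∘ ad y ∘ ad x = 0` for all `y`. -/
theorem lie_lie_lie_eq_zero (h2 : (2 : F) ≠ 0) {x : L} (hx : ∀ y : L, ⁅x, ⁅x, y⁆⁆ = 0)
    (y z : L) : ⁅x, ⁅y, ⁅x, z⁆⁆⁆ = 0 := by
  -- Expanding `(ad x)²` on `[y, z]` by Leibniz leaves only the mixed term, counted twice.
  have h : (2 : F) • ⁅⁅x, y⁆, ⁅x, z⁆⁆ = 0 := by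
    have h1 := hx ⁅y, z⁆
    rw [leibniz_lie x y z, lie_add, leibniz_lie x ⁅x, y⁆ z, leibniz_lie x y ⁅x, z⁆, hx, hx,
      zero_lie, lie_zero, zero_add, add_zero] at h1
    rw [two_smul]; exact h1
  rw [leibniz_lie x y, hx, lie_zero, add_zero]
  exact (smul_eq_zero.1 h).resolve_left h2

/-- A bilinear form that is symmetric and associative. -/
structure IsInvariantForm (γ : LinearMap.BilinForm F L) : Prop where
  symm : ∀ x y : L, γ x y = γ y x
  assoc : ∀ x y z : L, γ x ⁅y, z⁆ = γ ⁅x, y⁆ z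

namespace IsInvariantForm

variable {γ : LinearMap.BilinForm F L} (hγ : IsInvariantForm γ)
include hγ

theorem lie_left (x y z : L) : γ ⁅x, y⁆ z = -γ y ⁅x, z⁆ := by
  rw [hγ.assoc, ← lie_skew, map_neg, LinearMap.neg_apply]

theorem lie_right (x y z : L) : γ y ⁅x, z⁆ = -γ ⁅x, y⁆ z := by
  rw [hγ.lie_left, neg_neg]

/-- An invariant form vanishes if it vanishes on generators against everything. -/
theorem eq_zero {s : Set L} (hs : LieSubalgebra.lieSpan F L s = ⊤)
    (h : ∀ x ∈ s, ∀ y, γ x y = 0) : γ = 0 := by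
  have : LinearMap.ker γ = ⊤ := by
    refine submodule_eq_top_of_lieSpan_eq_top hs _ (fun x hx => ?_) fun x hx y hy => ?_
    · rw [LinearMap.mem_ker]; ext y; exact h x hx y
    · rw [LinearMap.mem_ker] at hy ⊢
      ext z
      rw [hγ.lie_left, hy]; simp
  exact LinearMap.ker_eq_top.1 this

end IsInvariantForm

/-! ### Existence of the extremal form -/

theorem IsExtremal.exists_functional {x : L} (hx : IsExtremal F x) :
    ∃ g : Module.Dual F L, ∀ y, ⁅x, ⁅x, y⁆⁆ = g y • x := by
  choose c hc using hx.2
  refine ⟨⟨⟨c, fun y z => ?_⟩, fun a y => ?_⟩, hc⟩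
  · apply smul_left_injective F hx.1
    simp only [add_smul, ← hc, lie_add]
  · apply smul_left_injective F hx.1
    simp only [RingHom.id_apply, smul_eq_mul, mul_smul, ← hc, lie_smul]

/-- The functional `g` with `[x, [x, y]] = g y • x`, for `x` extremal. -/
def extremalFunctional (x : L) : Module.Dual F L :=
  open Classical in
  if hx : IsExtremal F x then hx.exists_functional.choose else 0

namespace IsExtremal

theorem lie_lie {x : L} (hx : IsExtremal F x) (y : L) :
    ⁅x, ⁅x, y⁆⁆ = extremalFunctional (F := F) x y • x := by
  rw [extremalFunctional, dif_pos hx]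
  exact hx.exists_functional.choose_spec y

theorem functional_eq {x : L} (hx : IsExtremal F x) {y : L} {c : F} (h : ⁅x, ⁅x, y⁆⁆ = c • x) :
    extremalFunctional (F := F) x y = c := by
  apply smul_left_injective F hx.1
  simp only
  rw [← h, hx.lie_lie]

theorem functional_lie {x : L} (hx : IsExtremal F x) (y : L) :
    extremalFunctional (F := F) x ⁅x, y⁆ = 0 := by
  apply hx.functional_eq
  rw [hx.lie_lie y, lie_smul, lie_self, smul_zero, zero_smul]

/-- The element `[x,[y,[x,y]]]` is a multiple of `[x,y]` in two ways, through `(ad y)² x` and, by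
Jacobi, through `(ad x)² y`. If `[x,y] = 0`, both functionals vanish. -/
theorem functional_comm {x y : L} (hx : IsExtremal F x) (hy : IsExtremal F y) :
    extremalFunctional (F := F) x y = extremalFunctional (F := F) y x := by
  by_cases h : ⁅x, y⁆ = 0
  · rw [hx.functional_eq (y := y) (c := 0), hy.functional_eq (y := x) (c := 0)]
    · rw [← lie_skew y x, h, neg_zero, lie_zero, zero_smul]
    · rw [h, lie_zero, zero_smul]
  · apply smul_left_injective F h
    simp only
    have h1 : ⁅x, ⁅y, ⁅x, y⁆⁆⁆ = -(extremalFunctional (F := F) y x • ⁅x, y⁆) := by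
      rw [← lie_skew x y, lie_neg, lie_neg, hy.lie_lie, lie_smul, lie_skew]
    have h3 : ⁅x, ⁅y, ⁅x, y⁆⁆⁆ = -(extremalFunctional (F := F) x y • ⁅x, y⁆) := by
      rw [leibniz_lie, lie_self, zero_add, hx.lie_lie, lie_smul, ← smul_neg, lie_skew]
    rw [h1] at h3
    exact (neg_injective h3).symm

end IsExtremal

/-- The exponential of `s • ad x`, for `x` extremal. -/
def expMap (x : L) (s : F) : L →ₗ[F] L :=
  LinearMap.id + s • (LieAlgebra.ad F L x : L →ₗ[F] L) +
    (s * s / 2) • (extremalFunctional (F := F) x).smulRight x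

theorem expMap_apply (x : L) (s : F) (y : L) :
    expMap x s y = y + s • ⁅x, y⁆ + (s * s / 2 * extremalFunctional (F := F) x y) • x := by
  simp [expMap, mul_smul]

/-! ### Exponentials of extremal elements as automorphisms -/

section Exp

variable (h2 : (2 : F) ≠ 0) {x : L} (hx : IsExtremal F x)
include h2 hx

/-- The exponential series stops after the square since `(ad x)³ = 0`. Multiplicativity needs the
mixed bracket `[[x,y],[x,z]]`, which comes from applying `(ad x)²` to `[y,z]` and dividing by 2. -/
theorem expMap_lie (s : F) (y z : L) :
    ⁅expMap x s y, expMap x s z⁆ = expMap x s ⁅y, z⁆ := by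
  have h := hx.lie_lie ⁅y, z⁆
  have hxy := hx.lie_lie y
  have hxz := hx.lie_lie z
  have h3 : (2 : F) • ⁅⁅x, y⁆, ⁅x, z⁆⁆ = extremalFunctional (F := F) x ⁅y, z⁆ • x
      - extremalFunctional (F := F) x y • ⁅x, z⁆ + extremalFunctional (F := F) x z • ⁅x, y⁆ := by
    rw [leibniz_lie x y z, lie_add, leibniz_lie x ⁅x, y⁆ z, leibniz_lie x y ⁅x, z⁆, hxy, hxz,
      smul_lie, lie_smul, ← lie_skew x y] at h
    rw [← h, two_smul, ← lie_skew x y]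
    module
  have h4 : ⁅⁅x, y⁆, ⁅x, z⁆⁆ = (2 : F)⁻¹ • (extremalFunctional (F := F) x ⁅y, z⁆ • x
      - extremalFunctional (F := F) x y • ⁅x, z⁆ + extremalFunctional (F := F) x z • ⁅x, y⁆) := by
    rw [← h3, smul_smul, inv_mul_cancel₀ h2, one_smul]
  simp only [expMap_apply, add_lie, lie_add, smul_lie, lie_smul, lie_self]
  rw [h4, ← lie_skew ⁅x, y⁆ x, hxy, hxz, leibniz_lie x y z, ← lie_skew x y]
  generalize extremalFunctional (F := F) x y = p
  generalize extremalFunctional (F := F) x z = q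
  generalize extremalFunctional (F := F) x ⁅y, z⁆ = r
  match_scalars <;> field_simp <;> ring

theorem expMap_neg_expMap (s : F) (y : L) : expMap x (-s) (expMap x s y) = y := by
  rw [expMap_apply, expMap_apply]
  have h0 : extremalFunctional (F := F) x x = 0 := hx.functional_eq (by simp)
  simp only [lie_add, lie_smul, lie_self, hx.lie_lie, map_add, map_smul, hx.functional_lie, h0]
  simp only [smul_eq_mul]
  have : s * s = 2⁻¹ * (s * s) + 2⁻¹ * (s * s) := by field_simp; ring
  match_scalars <;> field_simp <;> ring

theorem expMap_expMap_neg (s : F) (y : L) : expMap x s (expMap x (-s) y) = y := by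
  simpa using expMap_neg_expMap h2 hx (-s) y

theorem IsExtremal.expMap_lie_lie {y : L} (hy : IsExtremal F y) (s : F) (z : L) :
    ⁅expMap x s y, ⁅expMap x s y, expMap x s z⁆⁆
      = extremalFunctional (F := F) y z • expMap x s y := by
  rw [expMap_lie h2 hx, expMap_lie h2 hx, hy.lie_lie, map_smul]

theorem IsExtremal.expMap {y : L} (hy : IsExtremal F y) (s : F) :
    IsExtremal F (expMap x s y) := by
  refine ⟨fun h => hy.1 ?_, fun z => ?_⟩
  · rw [← expMap_neg_expMap h2 hx s y, h, map_zero]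
  · rw [← expMap_expMap_neg h2 hx s z]
    exact ⟨_, hx.expMap_lie_lie h2 hy s _⟩

theorem IsExtremal.functional_expMap {y : L} (hy : IsExtremal F y) (s : F) (z : L) :
    extremalFunctional (F := F) (ExtremalLie.expMap x s y) (ExtremalLie.expMap x s z)
      = extremalFunctional (F := F) y z :=
  (hx.expMap h2 hy s).functional_eq (hx.expMap_lie_lie h2 hy s z)

omit hx in
theorem lie_eq_expMap_sub (y : L) :
    ⁅x, y⁆ = (2 : F)⁻¹ • (expMap x (1 : F) y - expMap x (-1 : F) y) := by
  rw [expMap_apply, expMap_apply]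
  match_scalars <;> field_simp <;> ring

end Exp

/-- For `x` extremal, `[x,y]` is half of `exp(ad x) y - exp(-ad x) y`, a difference of extremal
elements when `y` is extremal. So the span is stable under the generators. -/
theorem span_isExtremal_eq_top (h2 : (2 : F) ≠ 0) {s : Set L}
    (hs : LieSubalgebra.lieSpan F L s = ⊤) (hext : ∀ x ∈ s, IsExtremal F x) :
    Submodule.span F {x : L | IsExtremal F x} = ⊤ := by
  refine submodule_eq_top_of_lieSpan_eq_top hs _
    (fun x hx => Submodule.subset_span (hext x hx)) fun x hx y hy => ?_
  induction hy using Submodule.span_induction with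
  | mem y hy =>
    rw [lie_eq_expMap_sub h2]
    exact Submodule.smul_mem _ _ (Submodule.sub_mem _
      (Submodule.subset_span ((hext x hx).expMap h2 hy 1))
      (Submodule.subset_span ((hext x hx).expMap h2 hy (-1))))
  | zero => rw [lie_zero]; exact Submodule.zero_mem _
  | add y z _ _ h1 h3 => rw [lie_add]; exact Submodule.add_mem _ h1 h3
  | smul c y _ h1 => rw [lie_smul]; exact Submodule.smul_mem _ _ h1

/-- Define the form on a basis of extremal elements by their functionals. Symmetry of the
functionals between extremal elements extends the formula to extremal elements outside the basis. -/
theorem exists_bilinForm_extremalFunctional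
    (hspan : Submodule.span F {x : L | IsExtremal F x} = ⊤) :
    ∃ β : LinearMap.BilinForm F L,
      ∀ x, IsExtremal F x → ∀ y, β x y = extremalFunctional (F := F) x y := by
  obtain ⟨b, hb, hspanb, hli⟩ := exists_linearIndependent F {x : L | IsExtremal F x}
  let B : Module.Basis b F L := Module.Basis.mk hli (by
    rw [Subtype.range_coe, hspanb, hspan])
  have hB : ∀ i : b, B i = i := fun i => by simp [B]
  let β : LinearMap.BilinForm F L := B.constr F fun i => extremalFunctional (F := F) (i : L)
  have hβ : ∀ i : b, β i = extremalFunctional (F := F) (i : L) := fun i => by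
    conv_lhs => rw [← hB i]
    exact B.constr_basis F _ i
  have key : ∀ e, IsExtremal F e → ∀ x, β x e = extremalFunctional (F := F) e x := by
    intro e he x
    have : (LinearMap.flip β) e = extremalFunctional (F := F) e := by
      refine B.ext fun i => ?_
      rw [hB, LinearMap.flip_apply, hβ]
      exact (hb i.2).functional_comm he
    rw [← this, LinearMap.flip_apply]
  refine ⟨β, fun x hx y => ?_⟩
  have : β x = extremalFunctional (F := F) x := by
    refine LinearMap.ext_on hspan fun e he => ?_
    rw [key e he]
    exact IsExtremal.functional_comm he hx
  rw [this]

/-- A Lie algebra generated by extremal elements has an extremal form. -/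
theorem exists_isExtremalForm (h2 : (2 : F) ≠ 0) {s : Set L}
    (hs : LieSubalgebra.lieSpan F L s = ⊤) (hext : ∀ x ∈ s, IsExtremal F x) :
    ∃ β : LinearMap.BilinForm F L, IsExtremalForm β := by
  have hspan := span_isExtremal_eq_top h2 hs hext
  obtain ⟨β, hβ⟩ := exists_bilinForm_extremalFunctional hspan
  have hsymm : ∀ x y, β x y = β y x := by
    intro x y
    have hx : x ∈ Submodule.span F {x : L | IsExtremal F x} := hspan ▸ Submodule.mem_top
    have hy : y ∈ Submodule.span F {x : L | IsExtremal F x} := hspan ▸ Submodule.mem_top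
    induction hx using Submodule.span_induction with
    | mem x hx =>
      induction hy using Submodule.span_induction with
      | mem y hy => rw [hβ x hx, hβ y hy]; exact IsExtremal.functional_comm hx hy
      | zero => simp
      | add _ _ _ _ h h' => simp [h, h']
      | smul c _ _ h => simp [h]
    | zero => simp
    | add _ _ _ _ h h' => simp [h, h']
    | smul c _ _ h => simp [h]
  have hexp : ∀ x, IsExtremal F x → ∀ (t : F) (y z : L),
      β (expMap x t y) (expMap x t z) = β y z := by
    intro x hx t y z
    have hy : y ∈ Submodule.span F {x : L | IsExtremal F x} := hspan ▸ Submodule.mem_top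
    induction hy using Submodule.span_induction with
    | mem y hy =>
      rw [hβ y hy, hβ _ (hx.expMap h2 hy t), hx.functional_expMap h2 hy]
    | zero => simp
    | add _ _ _ _ h h' => simp [h, h']
    | smul c _ _ h => simp [h]
  have hinv : ∀ x y z : L, β ⁅x, y⁆ z = -β y ⁅x, z⁆ := by
    intro x y z
    have hx : x ∈ Submodule.span F {x : L | IsExtremal F x} := hspan ▸ Submodule.mem_top
    induction hx using Submodule.span_induction with
    | mem x hx =>
      -- Subtracting the invariance under `exp(ad x)` and `exp(-ad x)` isolates the odd terms; the
      -- cubic ones vanish by `hz` and `hz'`.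
      have e1 := hexp x hx 1 y z
      have e2 := hexp x hx (-1) y z
      have hz : ∀ u, β x ⁅x, u⁆ = 0 := fun u => by rw [hβ x hx, hx.functional_lie]
      have hz' : ∀ u, β ⁅x, u⁆ x = 0 := fun u => by rw [hsymm, hz]
      simp only [expMap_apply, map_add, map_smul, LinearMap.add_apply, LinearMap.smul_apply, hz,
        hz', smul_eq_mul] at e1 e2
      have : (2 : F) * (β ⁅x, y⁆ z + β y ⁅x, z⁆) = 0 := by linear_combination e1 - e2
      exact eq_neg_of_add_eq_zero_left ((mul_eq_zero.1 this).resolve_left h2)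
    | zero => simp
    | add _ _ _ _ h h' => simp [h, h']; ring
    | smul c _ _ h => simp [h]
  refine ⟨β, fun x hx y => by rw [hβ x hx, hx.lie_lie], fun x y z => ?_, hsymm⟩
  rw [← lie_skew x y, map_neg, LinearMap.neg_apply, hinv, neg_neg]

end General

/-! ### Quotients and generators -/

section Quotient

variable {F L L' : Type*} [Field F] [LieRing L] [LieAlgebra F L] [LieRing L'] [LieAlgebra F L']

/-- The projection to a quotient as a homomorphism of Lie algebras. -/
def quotHom (I : LieIdeal F L) : L →ₗ⁅F⁆ L ⧸ I where
  toFun := LieSubmodule.Quotient.mk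
  map_add' _ _ := rfl
  map_smul' _ _ := rfl
  map_lie' := rfl

theorem quotHom_surjective (I : LieIdeal F L) : Function.Surjective (quotHom I) :=
  Quot.mk_surjective

theorem quotHom_eq_zero {I : LieIdeal F L} {x : L} : quotHom I x = 0 ↔ x ∈ I :=
  LieSubmodule.Quotient.mk_eq_zero'

/-- A homomorphism that vanishes on an ideal factors through the quotient. -/
def quotLift (I : LieIdeal F L) (φ : L →ₗ⁅F⁆ L') (h : ∀ x ∈ I, φ x = 0) : L ⧸ I →ₗ⁅F⁆ L' where
  toLinearMap := Submodule.liftQ I.toSubmodule (φ : L →ₗ[F] L') h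
  map_lie' := by
    intro x y
    obtain ⟨x, rfl⟩ := quotHom_surjective I x
    obtain ⟨y, rfl⟩ := quotHom_surjective I y
    rw [← LieHom.map_lie]
    exact φ.map_lie x y

theorem lieSpan_image_eq_top {s : Set L} (hs : LieSubalgebra.lieSpan F L s = ⊤)
    (φ : L →ₗ⁅F⁆ L') (hφ : Function.Surjective φ) :
    LieSubalgebra.lieSpan F L' (φ '' s) = ⊤ := by
  have h : LieSubalgebra.lieSpan F L s ≤ (LieSubalgebra.lieSpan F L' (φ '' s)).comap φ :=
    LieSubalgebra.lieSpan_le.2 fun x hx =>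
      LieSubalgebra.subset_lieSpan (Set.mem_image_of_mem φ hx)
  rw [hs] at h
  rw [eq_top_iff]
  intro y _
  obtain ⟨x, rfl⟩ := hφ y
  exact h (LieSubalgebra.mem_top x)

theorem lieSpan_range_of (V : Type*) :
    LieSubalgebra.lieSpan F (FreeLieAlgebra F V) (Set.range (FreeLieAlgebra.of F)) = ⊤ := by
  set K := LieSubalgebra.lieSpan F (FreeLieAlgebra F V) (Set.range (FreeLieAlgebra.of F))
  -- Followed by the inclusion of `K`, this lift fixes the generators, so it is the identity and `K`
  -- is everything.
  let φ : FreeLieAlgebra F V →ₗ⁅F⁆ K := FreeLieAlgebra.lift F fun v =>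
    ⟨FreeLieAlgebra.of F v, LieSubalgebra.subset_lieSpan ⟨v, rfl⟩⟩
  have h : K.incl.comp φ = LieHom.id := by
    refine FreeLieAlgebra.hom_ext fun v => ?_
    simp [φ]
  rw [eq_top_iff]
  intro x _
  have := LieHom.congr_fun h x
  simp only [LieHom.comp_apply, LieHom.id_apply] at this
  rw [← this]
  exact (φ x).2

end Quotient

/-! ### The graph algebra, its universal property and its quotients -/

section Graph

variable {F : Type*} [Field F] {V : Type*} {Γ : SimpleGraph V}

theorem lieSpan_range_gen :
    LieSubalgebra.lieSpan F (GraphLie F Γ) (Set.range (gen F Γ)) = ⊤ := by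
  have := lieSpan_image_eq_top (lieSpan_range_of (F := F) V) (quotHom (commIdeal F Γ))
    (quotHom_surjective _)
  rw [← Set.range_comp] at this
  exact this

/-- The projection to `ExtLie f` as a homomorphism. -/
def projHom (f : Functionals F Γ) : GraphLie F Γ →ₗ⁅F⁆ ExtLie f := quotHom (extIdeal f)

theorem projHom_surjective (f : Functionals F Γ) : Function.Surjective (projHom f) :=
  quotHom_surjective _

theorem projHom_eq_zero {f : Functionals F Γ} {x : GraphLie F Γ} :
    projHom f x = 0 ↔ x ∈ extIdeal f :=
  quotHom_eq_zero

theorem lieSpan_range_proj_gen (f : Functionals F Γ) :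
    LieSubalgebra.lieSpan F (ExtLie f) (Set.range fun i => projHom f (gen F Γ i)) = ⊤ := by
  have := lieSpan_image_eq_top (lieSpan_range_gen (F := F) (Γ := Γ)) (projHom f)
    (projHom_surjective f)
  rw [← Set.range_comp] at this
  exact this

theorem gen_lie_gen {i j : V} (h : ¬ Γ.Adj i j) : ⁅gen F Γ i, gen F Γ j⁆ = 0 :=
  quotHom_eq_zero.2 (LieSubmodule.subset_lieSpan ⟨i, j, h, rfl⟩)

theorem projHom_gen_lie_lie (f : Functionals F Γ) (i : V) (y : GraphLie F Γ) :
    ⁅projHom f (gen F Γ i), ⁅projHom f (gen F Γ i), projHom f y⁆⁆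
      = f i y • projHom f (gen F Γ i) := by
  rw [← sub_eq_zero, ← LieHom.map_lie, ← LieHom.map_lie, ← map_smul, ← map_sub]
  exact projHom_eq_zero.2 (LieSubmodule.subset_lieSpan ⟨i, y, rfl⟩)

theorem isExtremal_projHom_gen {f : Functionals F Γ} {i : V}
    (h : projHom f (gen F Γ i) ≠ 0) : IsExtremal F (projHom f (gen F Γ i)) := by
  refine ⟨h, fun y => ?_⟩
  obtain ⟨y, rfl⟩ := projHom_surjective f y
  exact ⟨_, projHom_gen_lie_lie f i y⟩

/-- The homomorphism from the graph algebra that prescribes the images of the generators. -/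
def graphLift {L : Type*} [LieRing L] [LieAlgebra F L] (φ : V → L)
    (hφ : ∀ i j, ¬ Γ.Adj i j → ⁅φ i, φ j⁆ = 0) : GraphLie F Γ →ₗ⁅F⁆ L :=
  quotLift (commIdeal F Γ) (FreeLieAlgebra.lift F φ) fun x hx => by
    have : commIdeal F Γ ≤ (FreeLieAlgebra.lift F φ).ker := by
      refine LieSubmodule.lieSpan_le.2 ?_
      rintro _ ⟨i, j, hij, rfl⟩
      simp [hφ i j hij]
    exact this hx

@[simp]
theorem graphLift_gen {L : Type*} [LieRing L] [LieAlgebra F L] (φ : V → L)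
    (hφ : ∀ i j, ¬ Γ.Adj i j → ⁅φ i, φ j⁆ = 0) (i : V) :
    graphLift φ hφ (gen F Γ i) = φ i := by
  change FreeLieAlgebra.lift F φ (FreeLieAlgebra.of F i) = φ i
  simp

/-! ### The grading by length -/

open scoped TensorProduct

variable (F Γ) in
/-- The homomorphism `x_i ↦ T x_i` to the polynomials over the graph algebra. -/
def degreeHom : GraphLie F Γ →ₗ⁅F⁆ LieAlgebra.loopAlgebra F ℕ (GraphLie F Γ) :=
  graphLift (fun i => AddMonoidAlgebra.single 1 1 ⊗ₜ gen F Γ i) fun i j hij => by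
    rw [LieAlgebra.ExtendScalars.bracket_tmul, gen_lie_gen hij, TensorProduct.tmul_zero]

variable (F Γ) in
/-- The elements of degree `d`. -/
def homogeneous (d : ℕ) : Submodule F (GraphLie F Γ) :=
  LinearMap.eqLocus (degreeHom F Γ : GraphLie F Γ →ₗ[F] _)
    (TensorProduct.mk F (AddMonoidAlgebra F ℕ) (GraphLie F Γ) (AddMonoidAlgebra.single d 1))

theorem mem_homogeneous {d : ℕ} {u : GraphLie F Γ} :
    u ∈ homogeneous F Γ d ↔ degreeHom F Γ u = AddMonoidAlgebra.single d 1 ⊗ₜ u :=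
  Iff.rfl

theorem gen_mem_homogeneous (i : V) : gen F Γ i ∈ homogeneous F Γ 1 := by
  rw [mem_homogeneous, degreeHom, graphLift_gen]

theorem lie_mem_homogeneous {a b : ℕ} {u v : GraphLie F Γ} (hu : u ∈ homogeneous F Γ a)
    (hv : v ∈ homogeneous F Γ b) : ⁅u, v⁆ ∈ homogeneous F Γ (a + b) := by
  rw [mem_homogeneous] at *
  rw [LieHom.map_lie, hu, hv, LieAlgebra.ExtendScalars.bracket_tmul,
    AddMonoidAlgebra.single_mul_single, one_mul]

theorem iSup_homogeneous : ⨆ d, homogeneous F Γ d = ⊤ := by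
  refine submodule_eq_top_of_lieSpan_eq_top lieSpan_range_gen _ ?_ ?_
  · rintro _ ⟨i, rfl⟩
    exact Submodule.mem_iSup_of_mem 1 (gen_mem_homogeneous i)
  · rintro _ ⟨i, rfl⟩ y hy
    induction hy using Submodule.iSup_induction' with
    | mem d y hy =>
      exact Submodule.mem_iSup_of_mem (1 + d) (lie_mem_homogeneous (gen_mem_homogeneous i) hy)
    | zero => rw [lie_zero]; exact Submodule.zero_mem _
    | add y z _ _ h h' => rw [lie_add]; exact Submodule.add_mem _ h h'

theorem homogeneous_induction {p : GraphLie F Γ → Prop} (u : GraphLie F Γ)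
    (mem : ∀ d, ∀ v ∈ homogeneous F Γ d, p v) (zero : p 0)
    (add : ∀ v w, p v → p w → p (v + w)) : p u := by
  have hu : u ∈ ⨆ d, homogeneous F Γ d := iSup_homogeneous (F := F) (Γ := Γ) ▸ Submodule.mem_top
  induction hu using Submodule.iSup_induction' with
  | mem d y hy => exact mem d y hy
  | zero => exact zero
  | add y z _ _ h h' => exact add y z h h'

variable (F Γ) in
/-- The projection to the component of degree `d`. -/
def component (d : ℕ) : GraphLie F Γ →ₗ[F] GraphLie F Γ :=
  Finsupp.lapply d ∘ₗ (LieAlgebra.LoopAlgebra.toFinsupp F ℕ (GraphLie F Γ)).toLinearMap ∘ₗ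
    (degreeHom F Γ : GraphLie F Γ →ₗ[F] _)

theorem component_of_mem {d : ℕ} (e : ℕ) {u : GraphLie F Γ} (hu : u ∈ homogeneous F Γ d) :
    component F Γ e u = if d = e then u else 0 := by
  rw [mem_homogeneous] at hu
  simp only [component, LinearMap.comp_apply, LieHom.coe_toLinearMap, hu, LinearEquiv.coe_coe,
    LieAlgebra.LoopAlgebra.toFinsupp_single_tmul, Finsupp.lapply_apply, Finsupp.single_apply]

theorem component_self {d : ℕ} {u : GraphLie F Γ} (hu : u ∈ homogeneous F Γ d) :
    component F Γ d u = u := by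
  rw [component_of_mem d hu, if_pos rfl]

theorem mono_mem_homogeneous (w : List V) : mono F Γ w ∈ homogeneous F Γ w.length := by
  induction w with
  | nil => exact Submodule.zero_mem _
  | cons i w ih =>
    cases w with
    | nil => exact gen_mem_homogeneous i
    | cons j w =>
      rw [List.length_cons, add_comm]
      exact lie_mem_homogeneous (gen_mem_homogeneous i) ih

end Graph

/-! ### Comparison of the algebra for `f` with the one for `f = 0` -/

section Rank

variable {F : Type*} [Field F] {V : Type*} {Γ : SimpleGraph V}

/-- The coefficient of `x_i` is a homomorphism to a one-dimensional abelian Lie algebra, and it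
kills all double brackets. -/
theorem projHom_zero_gen_ne_zero (i : V) :
    projHom (0 : Functionals F Γ) (gen F Γ i) ≠ 0 := by
  classical
  let : LieRing F := LieRing.ofAssociativeRing
  let : LieAlgebra F F := LieAlgebra.ofAssociativeAlgebra
  have hb : ∀ a b : F, ⁅a, b⁆ = 0 := fun a b => by
    rw [LieRing.of_associative_ring_bracket, mul_comm, sub_self]
  let φ : GraphLie F Γ →ₗ⁅F⁆ F := graphLift (fun j => if j = i then 1 else 0) fun j k _ => hb _ _
  have hφ : extIdeal (0 : Functionals F Γ) ≤ φ.ker := by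
    refine LieSubmodule.lieSpan_le.2 ?_
    rintro _ ⟨j, y, rfl⟩
    simp [hb]
  intro h
  have h1 : φ (gen F Γ i) = 0 := hφ (projHom_eq_zero.1 h)
  simp [φ] at h1

theorem component_lie {p : ℕ} {u : GraphLie F Γ} (hu : u ∈ homogeneous F Γ p) (d : ℕ)
    (v : GraphLie F Γ) :
    component F Γ d ⁅u, v⁆ = if p ≤ d then ⁅u, component F Γ (d - p) v⁆ else 0 := by
  induction v using homogeneous_induction with
  | mem e v hv =>
    rw [component_of_mem d (lie_mem_homogeneous hu hv), component_of_mem _ hv]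
    by_cases h : p ≤ d
    · by_cases h' : p + e = d
      · rw [if_pos h', if_pos h, if_pos (by omega)]
      · rw [if_neg h', if_pos h, if_neg (by omega), lie_zero]
    · rw [if_neg h, if_neg (by omega)]
  | zero => simp
  | add v w hv hw =>
    rw [lie_add, map_add, hv, hw, map_add]
    split_ifs
    · rw [lie_add]
    · rw [add_zero]

/-- The elements that agree modulo `extIdeal f` with an element of degree less than `d`. -/
def lowerPart (f : Functionals F Γ) (d : ℕ) : Submodule F (GraphLie F Γ) :=
  (extIdeal f).toSubmodule ⊔ ⨆ e : Fin d, homogeneous F Γ e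

theorem lie_mem_lowerPart (f : Functionals F Γ) {p d : ℕ} {u v : GraphLie F Γ}
    (hu : u ∈ homogeneous F Γ p) (hv : v ∈ lowerPart f d) : ⁅u, v⁆ ∈ lowerPart f (p + d) := by
  have : lowerPart f d ≤ (lowerPart f (p + d)).comap (LieAlgebra.ad F _ u : _ →ₗ[F] _) := by
    refine sup_le (fun x hx => ?_) (iSup_le fun e x hx => ?_)
    · exact Submodule.mem_sup_left ((extIdeal f).lie_mem hx)
    · exact Submodule.mem_sup_right (Submodule.mem_iSup_of_mem ⟨p + e, by omega⟩
        (lie_mem_homogeneous hu hx))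
  exact this hv

theorem component_mem_lowerPart (f : Functionals F Γ) {v : GraphLie F Γ}
    (hv : v ∈ extIdeal (0 : Functionals F Γ)) (d : ℕ) : component F Γ d v ∈ lowerPart f d := by
  -- The condition defines an ideal, so it is enough to check it on the generators `[x_i,[x_i,y]]`.
  let J : LieIdeal F (GraphLie F Γ) :=
    { carrier := {v | ∀ d, component F Γ d v ∈ lowerPart f d}
      add_mem' := fun {a b} ha hb d => by
        rw [map_add]; exact Submodule.add_mem _ (ha d) (hb d)
      zero_mem' := fun d => by rw [map_zero]; exact Submodule.zero_mem _
      smul_mem' := fun c a ha d => by rw [map_smul]; exact Submodule.smul_mem _ c (ha d)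
      lie_mem := fun {u v} hv d => by
        induction u using homogeneous_induction with
        | mem p u hu =>
          rw [component_lie hu]
          split_ifs with h
          · have := lie_mem_lowerPart f hu (hv (d - p))
            rwa [Nat.add_sub_cancel' h] at this
          · exact Submodule.zero_mem _
        | zero => rw [zero_lie, map_zero]; exact Submodule.zero_mem _
        | add a b ha hb => rw [add_lie, map_add]; exact Submodule.add_mem _ ha hb }
  have hJ : extIdeal (0 : Functionals F Γ) ≤ J := by
    refine LieSubmodule.lieSpan_le.2 ?_
    rintro _ ⟨i, y, rfl⟩ d
    simp only [Pi.zero_apply, LinearMap.zero_apply, zero_smul, sub_zero]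
    induction y using homogeneous_induction with
    | mem p y hy =>
      have h := lie_mem_homogeneous (gen_mem_homogeneous (F := F) (Γ := Γ) i)
        (lie_mem_homogeneous (gen_mem_homogeneous i) hy)
      rw [component_of_mem d h]
      split_ifs with hd
      -- Modulo `extIdeal f` the double bracket is `f_i(y) x_i`, of degree 1, while `d = p + 2`.
      · rw [← sub_add_cancel ⁅gen F Γ i, ⁅gen F Γ i, y⁆⁆ (f i y • gen F Γ i)]
        exact Submodule.add_mem_sup (LieSubmodule.subset_lieSpan ⟨i, y, rfl⟩)
          (Submodule.smul_mem _ _ (Submodule.mem_iSup_of_mem ⟨1, by omega⟩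
            (gen_mem_homogeneous i)))
      · exact Submodule.zero_mem _
    | zero => simp
    | add a b ha hb =>
      rw [lie_add, lie_add, map_add]; exact Submodule.add_mem _ ha hb
  exact hJ hv d

theorem component_mem_span {b : Set (GraphLie F Γ)} (hb : ∀ u ∈ b, ∃ d, u ∈ homogeneous F Γ d)
    {t : GraphLie F Γ} (ht : t ∈ Submodule.span F b) (d : ℕ) :
    component F Γ d t ∈ Submodule.span F b := by
  induction ht using Submodule.span_induction with
  | mem u hu =>
    obtain ⟨e, he⟩ := hb u hu
    rw [component_of_mem d he]
    split_ifs
    · exact Submodule.subset_span hu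
    · exact Submodule.zero_mem _
  | zero => rw [map_zero]; exact Submodule.zero_mem _
  | add x y _ _ hx hy => rw [map_add]; exact Submodule.add_mem _ hx hy
  | smul c x _ hx => rw [map_smul]; exact Submodule.smul_mem _ _ hx

/-- Homogeneous elements that span the algebra for `f = 0` span the algebra for every `f`. -/
theorem span_projHom_eq_top {b : Set (GraphLie F Γ)}
    (hb : ∀ u ∈ b, ∃ d, u ∈ homogeneous F Γ d)
    (hspan : Submodule.span F (projHom (0 : Functionals F Γ) '' b) = ⊤) (f : Functionals F Γ) :
    Submodule.span F (projHom f '' b) = ⊤ := by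
  have key : ∀ d, ∀ u ∈ homogeneous F Γ d, projHom f u ∈ Submodule.span F (projHom f '' b) := by
    intro d
    induction d using Nat.strong_induction_on with
    | _ d ih =>
      intro u hu
      have h0 : projHom (0 : Functionals F Γ) u
          ∈ Submodule.span F (projHom (0 : Functionals F Γ) '' b) :=
        hspan ▸ Submodule.mem_top
      have himg : ∀ g : Functionals F Γ, Submodule.span F (projHom g '' b)
          = (Submodule.span F b).map (projHom g : GraphLie F Γ →ₗ[F] ExtLie g) := fun g =>
        Submodule.span_image _
      rw [himg] at h0
      obtain ⟨t, ht, hut⟩ := h0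
      -- Modulo the ideal for `f = 0`, `u` is a combination of `b`. Passing to the ideal for `f`
      -- costs an error of degree below `d`, which the induction hypothesis absorbs.
      have hI : u - t ∈ extIdeal (0 : Functionals F Γ) := by
        rw [← projHom_eq_zero, map_sub, sub_eq_zero]; exact hut.symm
      have hc := component_mem_lowerPart f hI d
      rw [map_sub, component_self hu] at hc
      have hlow : lowerPart f d ≤ (Submodule.span F (projHom f '' b)).comap
          (projHom f : GraphLie F Γ →ₗ[F] ExtLie f) := by
        refine sup_le (fun x hx => ?_) (iSup_le fun e x hx => ih e e.2 x hx)
        have : projHom f x = 0 := projHom_eq_zero.2 hx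
        rw [Submodule.mem_comap, LieHom.coe_toLinearMap, this]
        exact Submodule.zero_mem _
      have h1 : projHom f (u - component F Γ d t) ∈ Submodule.span F (projHom f '' b) := hlow hc
      have h2 : projHom f (component F Γ d t) ∈ Submodule.span F (projHom f '' b) := by
        rw [himg]
        exact ⟨_, component_mem_span hb ht d, rfl⟩
      have := Submodule.add_mem _ h1 h2
      rwa [← map_add, sub_add_cancel] at this
  rw [eq_top_iff]
  intro x _
  obtain ⟨u, rfl⟩ := projHom_surjective f x
  induction u using homogeneous_induction with
  | mem d u hu => exact key d u hu
  | zero => rw [map_zero]; exact Submodule.zero_mem _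
  | add a b ha hb =>
    rw [map_add]; exact Submodule.add_mem _ (ha trivial) (hb trivial)

/-- On the parameter space the generators do not vanish. -/
theorem projHom_gen_ne_zero [Module.Finite F (ExtLie (0 : Functionals F Γ))]
    {f : Functionals F Γ} (hf : f ∈ ParamSpace F Γ) (i : V) : projHom f (gen F Γ i) ≠ 0 := by
  let H : Set (GraphLie F Γ) := {u | ∃ d, u ∈ homogeneous F Γ d}
  have hs : LinearIndepOn F (projHom (0 : Functionals F Γ)) {gen F Γ i} :=
    LinearIndepOn.singleton (projHom_zero_gen_ne_zero i)
  -- A set of homogeneous elements that contains `x_i` and maps to a basis for `f = 0`.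
  obtain ⟨b, hbH, hib, hspan, hli⟩ := exists_linearIndepOn_extension hs
    (t := H) (Set.singleton_subset_iff.2 ⟨1, gen_mem_homogeneous i⟩)
  have hH : Submodule.span F H = ⊤ := by
    rw [eq_top_iff, ← iSup_homogeneous]
    exact iSup_le fun d u hu => Submodule.subset_span ⟨d, hu⟩
  have htop : Submodule.span F (projHom (0 : Functionals F Γ) '' b) = ⊤ := by
    rw [eq_top_iff]
    intro x _
    obtain ⟨u, rfl⟩ := projHom_surjective _ x
    have hu : u ∈ Submodule.span F H := hH ▸ Submodule.mem_top
    induction hu using Submodule.span_induction with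
    | mem u hu => exact hspan ⟨u, hu, rfl⟩
    | zero => rw [map_zero]; exact Submodule.zero_mem _
    | add x y _ _ hx hy => rw [map_add]; exact Submodule.add_mem _ (hx trivial) (hy trivial)
    | smul c x _ hx => rw [map_smul]; exact Submodule.smul_mem _ _ (hx trivial)
  have htopf := span_projHom_eq_top hbH htop f
  rw [Set.image_eq_range] at htop htopf
  let B := Module.Basis.mk hli htop.ge
  have : Finite b := Module.Finite.finite_basis B
  let _ : Fintype b := Fintype.ofFinite b
  -- The images of `b` for `f` span and are as many as the dimension, so they are independent; `x_i`
  -- is one of them.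
  have hcard : Fintype.card b = Module.finrank F (ExtLie f) := by
    rw [Module.finrank, hf, ← Module.finrank, Module.finrank_eq_card_basis B]
  have hlif := linearIndependent_of_top_le_span_of_card_eq_finrank htopf.ge hcard
  exact hlif.ne_zero ⟨gen F Γ i, hib rfl⟩

end Rank

/-! ### Rigidity -/

section Rigidity

variable {F : Type*} [Field F] {V : Type*} {Γ : SimpleGraph V}

/-- A linear section of the projection transports the form; the radical condition makes the choice
irrelevant. -/
theorem IsInvariantForm.exists_quotient {L : Type*} [LieRing L] [LieAlgebra F L]
    {γ : LinearMap.BilinForm F L} (hγ : IsInvariantForm γ) (I : LieIdeal F L)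
    (hI : ∀ x ∈ I, ∀ y, γ x y = 0) :
    ∃ γ' : LinearMap.BilinForm F (L ⧸ I), IsInvariantForm γ' ∧
      ∀ x y, γ' (quotHom I x) (quotHom I y) = γ x y := by
  obtain ⟨s, hs⟩ := LinearMap.exists_rightInverse_of_surjective
    (quotHom I : L →ₗ[F] L ⧸ I) (LinearMap.range_eq_top.2 (quotHom_surjective I))
  have hs' : ∀ x, quotHom I (s x) = x := fun x => LinearMap.congr_fun hs x
  have hmem : ∀ x, s (quotHom I x) - x ∈ I := fun x => by
    rw [← quotHom_eq_zero, map_sub, hs', sub_self]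
  have h1 : ∀ x y, γ.compl₁₂ s s (quotHom I x) (quotHom I y) = γ x y := by
    intro x y
    have e1 : γ (s (quotHom I x)) = γ x := by
      ext z
      rw [← sub_eq_zero, ← LinearMap.sub_apply, ← map_sub]
      exact hI _ (hmem x) z
    have e2 : γ x (s (quotHom I y)) = γ x y := by
      rw [← sub_eq_zero, ← map_sub, hγ.symm]
      exact hI _ (hmem y) x
    rw [LinearMap.compl₁₂_apply, e1, e2]
  refine ⟨γ.compl₁₂ s s, ⟨fun x y => ?_, fun x y z => ?_⟩, h1⟩
  · exact hγ.symm _ _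
  · obtain ⟨x, rfl⟩ := quotHom_surjective I x
    obtain ⟨y, rfl⟩ := quotHom_surjective I y
    obtain ⟨z, rfl⟩ := quotHom_surjective I z
    rw [← LieHom.map_lie, ← LieHom.map_lie, h1, h1, hγ.assoc]

/-- The component of degree `d` of a bilinear form. -/
def formComponent (γ : LinearMap.BilinForm F (GraphLie F Γ)) (d : ℕ) :
    LinearMap.BilinForm F (GraphLie F Γ) :=
  ∑ p ∈ Finset.HasAntidiagonal.antidiagonal d, γ.compl₁₂ (component F Γ p.1) (component F Γ p.2)

theorem formComponent_apply (γ : LinearMap.BilinForm F (GraphLie F Γ)) (d : ℕ) {a b : ℕ}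
    {u v : GraphLie F Γ} (hu : u ∈ homogeneous F Γ a) (hv : v ∈ homogeneous F Γ b) :
    formComponent γ d u v = if a + b = d then γ u v else 0 := by
  simp only [formComponent, LinearMap.sum_apply, LinearMap.compl₁₂_apply, component_of_mem _ hu,
    component_of_mem _ hv]
  split_ifs with h
  · rw [Finset.sum_eq_single (a, b)]
    · simp
    · rintro ⟨p, q⟩ _ hpq
      by_cases h1 : a = p
      · by_cases h2 : b = q
        · exact absurd (by rw [h1, h2]) hpq
        · simp [h2]
      · simp [h1]
    · intro h'
      exact absurd (Finset.HasAntidiagonal.mem_antidiagonal.2 h) h'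
  · refine Finset.sum_eq_zero ?_
    rintro ⟨p, q⟩ hpq
    rw [Finset.HasAntidiagonal.mem_antidiagonal] at hpq
    by_cases h1 : a = p
    · have h2 : b ≠ q := fun h2 => h (by rw [h1, h2]; exact hpq)
      simp [h2]
    · simp [h1]

/-- Symmetry and associativity relate only values of the same total degree. -/
theorem IsInvariantForm.formComponent {γ : LinearMap.BilinForm F (GraphLie F Γ)}
    (hγ : IsInvariantForm γ) (d : ℕ) : IsInvariantForm (formComponent γ d) := by
  constructor
  · intro x y
    induction x using homogeneous_induction with
    | mem a x hx =>
      induction y using homogeneous_induction with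
      | mem b y hy =>
        rw [formComponent_apply γ d hx hy, formComponent_apply γ d hy hx, add_comm, hγ.symm]
      | zero => simp
      | add _ _ h h' => simp [h, h']
    | zero => simp
    | add _ _ h h' => simp [h, h']
  · intro x y z
    induction x using homogeneous_induction with
    | mem a x hx =>
      induction y using homogeneous_induction with
      | mem b y hy =>
        induction z using homogeneous_induction with
        | mem c z hz =>
          rw [formComponent_apply γ d hx (lie_mem_homogeneous hy hz),
            formComponent_apply γ d (lie_mem_homogeneous hx hy) hz, add_assoc, hγ.assoc]
        | zero => simp
        | add _ _ h h' => simp [h, h']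
      | zero => simp
      | add _ _ h h' => simp [h, h']
    | zero => simp
    | add _ _ h h' => simp [h, h']

/-- The extremal form, pulled back to the graph algebra. -/
theorem exists_pullback_extremalForm (h2 : (2 : F) ≠ 0) {f : Functionals F Γ}
    (hf : ∀ i, projHom f (gen F Γ i) ≠ 0) :
    ∃ B : LinearMap.BilinForm F (GraphLie F Γ), IsInvariantForm B ∧
      (∀ i y, B (gen F Γ i) y = f i y) ∧
      ∀ i y v, B ⁅gen F Γ i, ⁅gen F Γ i, y⁆⁆ v = f i y * B (gen F Γ i) v := by
  obtain ⟨β, h1, h3, h4⟩ := exists_isExtremalForm h2 (lieSpan_range_proj_gen f) (by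
    rintro _ ⟨i, rfl⟩
    exact isExtremal_projHom_gen (hf i))
  refine ⟨β.compl₁₂ (projHom f : GraphLie F Γ →ₗ[F] ExtLie f)
    (projHom f : GraphLie F Γ →ₗ[F] ExtLie f), ⟨fun x y => h4 _ _, fun x y z => ?_⟩,
    fun i y => ?_, fun i y v => ?_⟩
  · simp only [LinearMap.compl₁₂_apply, LieHom.coe_toLinearMap, LieHom.map_lie, h3]
  · apply smul_left_injective F (hf i)
    simp only [LinearMap.compl₁₂_apply, LieHom.coe_toLinearMap]
    rw [← h1 _ (isExtremal_projHom_gen (hf i)), projHom_gen_lie_lie]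
  · simp only [LinearMap.compl₁₂_apply, LieHom.coe_toLinearMap, LieHom.map_lie,
      projHom_gen_lie_lie, map_smul, LinearMap.smul_apply, smul_eq_mul]

theorem functional_eq_zero_of_not_adj {f : Functionals F Γ} {i j : V}
    (hf : projHom f (gen F Γ i) ≠ 0) (h : ¬ Γ.Adj i j) : f i (gen F Γ j) = 0 := by
  have := projHom_gen_lie_lie f i (gen F Γ j)
  rw [← LieHom.map_lie, gen_lie_gen h, map_zero, lie_zero] at this
  exact (smul_eq_zero.1 this.symm).resolve_right hf

/-- If invariant forms on the algebra for `f = 0` are determined by their values on pairs of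
generators and on a set `T` of further pairs of words, then points of the parameter space are
determined by the corresponding values. -/
theorem functionals_eq (h2 : (2 : F) ≠ 0) [Module.Finite F (ExtLie (0 : Functionals F Γ))]
    (T : Set (V × List V))
    (hT : ∀ γ : LinearMap.BilinForm F (ExtLie (0 : Functionals F Γ)), IsInvariantForm γ →
      (∀ i j, γ (projHom 0 (gen F Γ i)) (projHom 0 (gen F Γ j)) = 0) →
      (∀ p ∈ T, γ (projHom 0 (gen F Γ p.1)) (projHom 0 (mono F Γ p.2)) = 0) → γ = 0)
    {f f' : Functionals F Γ} (hf : f ∈ ParamSpace F Γ) (hf' : f' ∈ ParamSpace F Γ)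
    (E : V → V → Prop) (hE : ∀ i j, Γ.Adj i j → E i j ∨ E j i)
    (hedge : ∀ i j, E i j → f i (gen F Γ j) = f' i (gen F Γ j))
    (hval : ∀ p ∈ T, f p.1 (mono F Γ p.2) = f' p.1 (mono F Γ p.2)) : f = f' := by
  have hn := projHom_gen_ne_zero hf
  have hn' := projHom_gen_ne_zero hf'
  obtain ⟨B, hB, hBf, hBg⟩ := exists_pullback_extremalForm h2 hn
  obtain ⟨B', hB', hBf', hBg'⟩ := exists_pullback_extremalForm h2 hn'
  have hgg : ∀ i j, f i (gen F Γ j) = f' i (gen F Γ j) := by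
    intro i j
    by_cases h : Γ.Adj i j
    · rcases hE i j h with h | h
      · exact hedge i j h
      · rw [← hBf, ← hBf', hB.symm, hB'.symm, hBf, hBf']
        exact hedge j i h
    · rw [functional_eq_zero_of_not_adj (hn i) h, functional_eq_zero_of_not_adj (hn' i) h]
  have hγ : IsInvariantForm (B - B') :=
    ⟨fun x y => by simp only [LinearMap.sub_apply]; rw [hB.symm, hB'.symm],
      fun x y z => by simp only [LinearMap.sub_apply]; rw [hB.assoc, hB'.assoc]⟩
  -- Strong induction on the total degree: the degree `d` component of `B - B'` is shown to vanish.
  have key : ∀ d, ∀ a b, a + b = d → ∀ u ∈ homogeneous F Γ a, ∀ v ∈ homogeneous F Γ b,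
      B u v = B' u v := by
    intro d
    induction d using Nat.strong_induction_on with
    | _ d ih =>
      set γ := formComponent (B - B') d with hγdef
      have hγd : IsInvariantForm γ := hγ.formComponent d
      let rad : LieIdeal F (GraphLie F Γ) :=
        { LinearMap.ker γ with
          lie_mem := fun {x m} hm => by
            have hm' : γ m = 0 := hm
            change γ ⁅x, m⁆ = 0
            ext z
            rw [hγd.lie_left, hm']; simp }
      have hrad : extIdeal (0 : Functionals F Γ) ≤ rad := by
        refine LieSubmodule.lieSpan_le.2 ?_
        rintro _ ⟨i, y, rfl⟩
        change γ _ = 0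
        ext v
        simp only [Pi.zero_apply, LinearMap.zero_apply, zero_smul, sub_zero]
        induction y using homogeneous_induction with
        | mem p y hy =>
          induction v using homogeneous_induction with
          | mem q v hv =>
            rw [hγdef, formComponent_apply _ d (lie_mem_homogeneous (gen_mem_homogeneous i)
              (lie_mem_homogeneous (gen_mem_homogeneous i) hy)) hv]
            split_ifs with hd
            -- Here `d = p + q + 2`, and the value is a product of values in degrees `1 + p` and `1
            -- + q`, both below `d`.
            · rw [LinearMap.sub_apply, LinearMap.sub_apply, hBg, hBg', ← hBf, ← hBf',
                ih (1 + p) (by omega) 1 p rfl _ (gen_mem_homogeneous i) _ hy,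
                ih (1 + q) (by omega) 1 q rfl _ (gen_mem_homogeneous i) _ hv, sub_self]
            · rfl
          | zero => simp
          | add _ _ h h' => rw [map_add, h, h', add_zero]
        | zero => simp
        | add _ _ h h' => rw [lie_add, lie_add, map_add, LinearMap.add_apply, h, h', add_zero]
      obtain ⟨γ', hγ', hγγ'⟩ := hγd.exists_quotient (extIdeal (0 : Functionals F Γ))
        fun x hx y => by
          have : γ x = 0 := hrad hx
          rw [this]; rfl
      have hzero : γ' = 0 := by
        refine hT γ' hγ' (fun i j => ?_) fun p hp => ?_
        · refine (hγγ' _ _).trans ?_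
          rw [hγdef, formComponent_apply _ d (gen_mem_homogeneous i) (gen_mem_homogeneous j)]
          split_ifs
          · rw [LinearMap.sub_apply, LinearMap.sub_apply, hBf, hBf', hgg, sub_self]
          · rfl
        · refine (hγγ' _ _).trans ?_
          rw [hγdef, formComponent_apply _ d (gen_mem_homogeneous p.1) (mono_mem_homogeneous p.2)]
          split_ifs
          · rw [LinearMap.sub_apply, LinearMap.sub_apply, hBf, hBf', hval p hp, sub_self]
          · rfl
      intro a b hab u hu v hv
      have h := formComponent_apply (B - B') d hu hv
      rw [if_pos hab, ← hγdef, ← hγγ', hzero] at h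
      simp only [LinearMap.zero_apply, LinearMap.sub_apply] at h
      exact (sub_eq_zero.1 h.symm)
  funext i
  ext y
  rw [← hBf, ← hBf']
  induction y using homogeneous_induction with
  | mem d y hy => exact key _ 1 d rfl _ (gen_mem_homogeneous i) _ hy
  | zero => simp
  | add _ _ h h' => rw [map_add, map_add, h, h']

/-- The extremal form is determined by the functionals. -/
theorem extremalForm_unique {f : Functionals F Γ} (hf : ∀ i, projHom f (gen F Γ i) ≠ 0)
    {β β' : LinearMap.BilinForm F (ExtLie f)} (hβ : IsExtremalForm β) (hβ' : IsExtremalForm β') :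
    β = β' := by
  rw [← sub_eq_zero]
  have hinv : IsInvariantForm (β - β') :=
    ⟨fun x y => by simp only [LinearMap.sub_apply]; rw [hβ.2.2, hβ'.2.2],
      fun x y z => by simp only [LinearMap.sub_apply]; rw [hβ.2.1, hβ'.2.1]⟩
  refine hinv.eq_zero (lieSpan_range_proj_gen f) ?_
  rintro _ ⟨i, rfl⟩ y
  have h := isExtremal_projHom_gen (hf i)
  rw [LinearMap.sub_apply, LinearMap.sub_apply, sub_eq_zero]
  apply smul_left_injective F (hf i)
  simp only
  rw [← hβ.1 _ h, ← hβ'.1 _ h]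

/-- If values determine the point of the parameter space, they determine the extremal form. -/
theorem determinesForm_of_injective [Module.Finite F (ExtLie (0 : Functionals F Γ))] {T : Type*}
    {ψ : ParamSpace F Γ → T} (hψ : Function.Injective ψ) : DeterminesForm ψ := by
  intro f f' h β β' hβ hβ' u v
  obtain rfl := hψ h
  rw [extremalForm_unique (projHom_gen_ne_zero f.2) hβ hβ']

end Rigidity

/-! ### Sandwich algebras of a path with a triangle at either end -/

section Sandwich

variable {F L : Type*} [Field F] [LieRing L] [LieAlgebra F L]

variable (F) in
/-- A generating family `z₀, …, z_{m+4}` of sandwich elements, with `z_i` and `z_j` commuting unless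
`i`, `j` are consecutive or `{i, j}` is one of `{0, 2}`, `{m + 2, m + 4}`. -/
structure IsSandwichFamily (m : ℕ) (z : ℕ → L) : Prop where
  lieSpan_eq : LieSubalgebra.lieSpan F L (z '' Set.Iic (m + 4)) = ⊤
  sq : ∀ (j : ℕ) (y : L), ⁅z j, ⁅z j, y⁆⁆ = 0
  sand : ∀ (j : ℕ) (y u : L), ⁅z j, ⁅y, ⁅z j, u⁆⁆⁆ = 0
  comm : ∀ i j, i + 1 < j → ¬ (i = 0 ∧ j = 2) → ¬ (i = m + 2 ∧ j = m + 4) → ⁅z i, z j⁆ = 0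

variable (F) in
/-- The algebra of operators generated by `ad z₀, …, ad z_k`. -/
def wordAlg (z : ℕ → L) (k : ℕ) : Subalgebra F (Module.End F L) :=
  Algebra.adjoin F ((fun j => LieAlgebra.ad F L (z j)) '' Set.Iic k)

variable (F) in
/-- The subalgebra generated by `z₀, …, z_k`. -/
def partAlg (z : ℕ → L) (k : ℕ) : LieSubalgebra F L :=
  LieSubalgebra.lieSpan F L (z '' Set.Iic k)

variable (F) in
/-- The operator `z_k ⋯ z_2 z_0 z_1 z_2 ⋯ z_k`. -/
def bounce (z : ℕ → L) : ℕ → Module.End F L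
  | 0 => 1
  | 1 => LieAlgebra.ad F L (z 0) * LieAlgebra.ad F L (z 1)
  | k + 2 => LieAlgebra.ad F L (z (k + 2)) * bounce z (k + 1) * LieAlgebra.ad F L (z (k + 2))

variable {z : ℕ → L} {k : ℕ}

theorem ad_mem_wordAlg {j : ℕ} (hj : j ≤ k) : LieAlgebra.ad F L (z j) ∈ wordAlg F z k :=
  Algebra.subset_adjoin ⟨j, hj, rfl⟩

theorem wordAlg_mono {k' : ℕ} (h : k ≤ k') : wordAlg F z k ≤ wordAlg F z k' :=
  Algebra.adjoin_mono (Set.image_mono (Set.Iic_subset_Iic.2 h))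

theorem mem_partAlg {j : ℕ} (hj : j ≤ k) : z j ∈ partAlg F z k :=
  LieSubalgebra.subset_lieSpan ⟨j, hj, rfl⟩

theorem bounce_apply (k : ℕ) (u : L) :
    bounce F z (k + 2) u = ⁅z (k + 2), bounce F z (k + 1) ⁅z (k + 2), u⁆⁆ :=
  rfl

theorem bounce_mem_wordAlg (k : ℕ) : bounce F z k ∈ wordAlg F z k := by
  match k with
  | 0 => exact Subalgebra.one_mem _
  | 1 => exact Subalgebra.mul_mem _ (ad_mem_wordAlg (by omega)) (ad_mem_wordAlg (by omega))
  | k + 2 =>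
    exact Subalgebra.mul_mem _ (Subalgebra.mul_mem _ (ad_mem_wordAlg le_rfl)
      (wordAlg_mono (by omega) (bounce_mem_wordAlg (k + 1)))) (ad_mem_wordAlg le_rfl)

/-- Words are built by adding letters on the left. The induction over the generated algebra needs
the stronger claim that `p` maps all of `S` into `S` by left multiplication. -/
theorem wordAlg_induction (S : Submodule F (Module.End F L)) (h1 : 1 ∈ S)
    (hl : ∀ j ≤ k, ∀ p ∈ S, LieAlgebra.ad F L (z j) * p ∈ S) {p : Module.End F L}
    (hp : p ∈ wordAlg F z k) : p ∈ S := by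
  have : ∀ q ∈ S, p * q ∈ S := by
    induction hp using Algebra.adjoin_induction with
    | mem x hx =>
      obtain ⟨j, hj, rfl⟩ := hx
      exact hl j hj
    | algebraMap r =>
      intro q hq
      rw [Algebra.algebraMap_eq_smul_one, smul_mul_assoc, one_mul]
      exact S.smul_mem r hq
    | add x y _ _ hx hy => intro q hq; rw [add_mul]; exact S.add_mem (hx q hq) (hy q hq)
    | mul x y _ _ hx hy => intro q hq; rw [mul_assoc]; exact hx _ (hy q hq)
  simpa using this 1 h1

theorem partAlg_induction (S : Submodule F L) (hz : ∀ j ≤ k, z j ∈ S)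
    (hl : ∀ j ≤ k, ∀ u ∈ S, ⁅z j, u⁆ ∈ S) {u : L} (hu : u ∈ partAlg F z k) : u ∈ S := by
  refine lieSpan_le_submodule S ?_ ?_ hu
  · rintro _ ⟨j, hj, rfl⟩; exact hz j hj
  · rintro _ ⟨j, hj, rfl⟩; exact hl j hj

/-- By Jacobi, `ad y` commutes with every letter, hence with every word. -/
theorem wordAlg_apply_lie {y : L} (hy : ∀ j ≤ k, ⁅z j, y⁆ = 0) {p : Module.End F L}
    (hp : p ∈ wordAlg F z k) (u : L) : p ⁅y, u⁆ = ⁅y, p u⁆ := by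
  induction hp using Algebra.adjoin_induction generalizing u with
  | mem x hx =>
    obtain ⟨j, hj, rfl⟩ := hx
    simp only [LieAlgebra.ad_apply]
    rw [leibniz_lie, hy j hj, zero_lie, zero_add]
  | algebraMap r => simp [Algebra.algebraMap_eq_smul_one]
  | add p q _ _ hp hq => simp [hp, hq]
  | mul p q _ _ hp hq => simp [hp, hq]

/-- Operators act by scalars on elements killed by all letters. -/
theorem wordAlg_apply_of_killed {y : L} (hy : ∀ j ≤ k, ⁅z j, y⁆ = 0) {p : Module.End F L}
    (hp : p ∈ wordAlg F z k) : ∃ c : F, p y = c • y := by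
  induction hp using Algebra.adjoin_induction with
  | mem x hx =>
    obtain ⟨j, hj, rfl⟩ := hx
    exact ⟨0, by rw [LieAlgebra.ad_apply, hy j hj, zero_smul]⟩
  | algebraMap r => exact ⟨r, by simp [Algebra.algebraMap_eq_smul_one]⟩
  | add p q _ _ hp hq =>
    obtain ⟨c, hc⟩ := hp
    obtain ⟨d, hd⟩ := hq
    exact ⟨c + d, by rw [LinearMap.add_apply, hc, hd, add_smul]⟩
  | mul p q _ _ hp hq =>
    obtain ⟨c, hc⟩ := hp
    obtain ⟨d, hd⟩ := hq
    exact ⟨d * c, by rw [Module.End.mul_apply, hd, map_smul, hc, smul_smul]⟩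

/-- Only the constant term of `p` survives. -/
theorem mul_eq_smul_of_killed {P : Module.End F L}
    (hP : ∀ j ≤ k, LieAlgebra.ad F L (z j) * P = 0) {p : Module.End F L}
    (hp : p ∈ wordAlg F z k) : ∃ c : F, p * P = c • P := by
  induction hp using Algebra.adjoin_induction with
  | mem x hx =>
    obtain ⟨j, hj, rfl⟩ := hx
    exact ⟨0, by rw [hP j hj, zero_smul]⟩
  | algebraMap r => exact ⟨r, by simp [Algebra.algebraMap_eq_smul_one]⟩
  | add p q _ _ hp hq =>
    obtain ⟨c, hc⟩ := hp
    obtain ⟨d, hd⟩ := hq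
    exact ⟨c + d, by rw [add_mul, hc, hd, add_smul]⟩
  | mul p q _ _ hp hq =>
    obtain ⟨c, hc⟩ := hp
    obtain ⟨d, hd⟩ := hq
    exact ⟨d * c, by rw [mul_assoc, hd, mul_smul_comm, hc, smul_smul]⟩

theorem mul_eq_smul_of_killed_right {P : Module.End F L}
    (hP : ∀ j ≤ k, P * LieAlgebra.ad F L (z j) = 0) {p : Module.End F L}
    (hp : p ∈ wordAlg F z k) : ∃ c : F, P * p = c • P := by
  induction hp using Algebra.adjoin_induction with
  | mem x hx =>
    obtain ⟨j, hj, rfl⟩ := hx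
    exact ⟨0, by rw [hP j hj, zero_smul]⟩
  | algebraMap r => exact ⟨r, by simp [Algebra.algebraMap_eq_smul_one]⟩
  | add p q _ _ hp hq =>
    obtain ⟨c, hc⟩ := hp
    obtain ⟨d, hd⟩ := hq
    exact ⟨c + d, by rw [mul_add, hc, hd, add_smul]⟩
  | mul p q _ _ hp hq =>
    obtain ⟨c, hc⟩ := hp
    obtain ⟨d, hd⟩ := hq
    exact ⟨c * d, by rw [← mul_assoc, hc, smul_mul_assoc, hd, smul_smul]⟩

theorem ad_mem_wordAlg_of_mem_partAlg {u : L} (hu : u ∈ partAlg F z k) :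
    LieAlgebra.ad F L u ∈ wordAlg F z k := by
  refine partAlg_induction ((wordAlg F z k).toSubmodule.comap
    (LieAlgebra.ad F L : L →ₗ[F] Module.End F L)) (fun j hj => ad_mem_wordAlg hj)
    (fun j hj v hv => ?_) hu
  change LieAlgebra.ad F L ⁅z j, v⁆ ∈ wordAlg F z k
  have : LieAlgebra.ad F L ⁅z j, v⁆ = LieAlgebra.ad F L (z j) * LieAlgebra.ad F L v
      - LieAlgebra.ad F L v * LieAlgebra.ad F L (z j) := by
    ext u; exact lie_lie _ _ _
  rw [this]
  exact Subalgebra.sub_mem _ (Subalgebra.mul_mem _ (ad_mem_wordAlg hj) hv)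
    (Subalgebra.mul_mem _ hv (ad_mem_wordAlg hj))

theorem wordAlg_apply_mem_partAlg {p : Module.End F L} (hp : p ∈ wordAlg F z k) {u : L}
    (hu : u ∈ partAlg F z k) : p u ∈ partAlg F z k := by
  induction hp using Algebra.adjoin_induction generalizing u with
  | mem x hx =>
    obtain ⟨j, hj, rfl⟩ := hx
    exact (partAlg F z k).lie_mem (mem_partAlg hj) hu
  | algebraMap r =>
    rw [Algebra.algebraMap_eq_smul_one]
    exact (partAlg F z k).smul_mem r hu
  | add p q _ _ hp hq => exact (partAlg F z k).add_mem (hp hu) (hq hu)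
  | mul p q _ _ hp hq => exact hp (hq hu)

/-! ### Relations between sandwich elements -/

/-- The middle factors of `x y w x` commute if `x` is a sandwich. -/
theorem sandwich_swap {x : L} (hx : ∀ y u : L, ⁅x, ⁅y, ⁅x, u⁆⁆⁆ = 0) (y w u : L) :
    ⁅x, ⁅y, ⁅w, ⁅x, u⁆⁆⁆⁆ = ⁅x, ⁅w, ⁅y, ⁅x, u⁆⁆⁆⁆ := by
  have h := hx ⁅y, w⁆ u
  rw [lie_lie, lie_sub, sub_eq_zero] at h
  exact h

theorem sandwich_self {x : L} (hx : ∀ y u : L, ⁅x, ⁅y, ⁅x, u⁆⁆⁆ = 0) (y w : L) :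
    ⁅x, ⁅y, ⁅w, x⁆⁆⁆ = 0 := by
  rw [← lie_skew w x, lie_neg, lie_neg, hx, neg_zero]

/-- Split `[c,[y,x]]` by Leibniz. In one term `s` lets `y` pass and a pattern `y c y` arises; in the
other, `x` passes, and after swapping `y` and `c` between the two `x` a pattern `y x y` arises. -/
theorem sandwich_bounce {x y c : L} {s : Module.End F L}
    (hx : ∀ w u : L, ⁅x, ⁅w, ⁅x, u⁆⁆⁆ = 0) (hy : ∀ w u : L, ⁅y, ⁅w, ⁅y, u⁆⁆⁆ = 0)
    (hsx : ∀ u, s ⁅x, u⁆ = ⁅x, s u⁆) (hsy : ∀ u, s ⁅y, u⁆ = ⁅y, s u⁆) :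
    ⁅x, ⁅y, ⁅c, s ⁅c, ⁅y, x⁆⁆⁆⁆⁆ = 0 := by
  rw [leibniz_lie c y x, map_add, lie_add, lie_add, lie_add, hsy, hy, lie_zero, add_zero,
    ← lie_skew ⁅c, y⁆ x, map_neg, lie_neg, lie_neg, lie_neg, hsx, sandwich_swap hx,
    ← lie_skew c y, map_neg, hsy, lie_neg, lie_neg, hy]
  simp

/-! ### Structure of the operator algebras -/

theorem op_comp_eq_zero {x : L} (hx : ∀ w u : L, ⁅x, ⁅w, ⁅x, u⁆⁆⁆ = 0) (w : L) :
    LieAlgebra.ad F L x * LieAlgebra.ad F L w * LieAlgebra.ad F L x = 0 := by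
  ext u
  exact hx w u

namespace IsSandwichFamily

variable {m : ℕ} (h : IsSandwichFamily F m z)
include h

/-- The letters up to `k` commute with `z_{k+2}`. -/
theorem comm_succ {k : ℕ} (hk : 1 ≤ k) (hkm : k ≤ m + 1) : ∀ j ≤ k, ⁅z j, z (k + 2)⁆ = 0 :=
  fun j hj => h.comm _ _ (by omega) (by omega) (by omega)

theorem comm_last : ∀ j ≤ m + 1, ⁅z j, z (m + 4)⁆ = 0 :=
  fun j hj => h.comm _ _ (by omega) (by omega) (by omega)

theorem bounce_two (u : L) : bounce F z 2 u = ⁅z 2, ⁅z 1, ⁅z 0, ⁅z 2, u⁆⁆⁆⁆ := by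
  rw [sandwich_swap (h.sand 2)]; rfl

/-- A letter below the two top indices passes the outer letter and meets the inner bounce; the next
one forms a sandwich around the outer letter, and the outer letter itself squares to zero. -/
theorem lie_bounce {k : ℕ} (hk : k ≤ m + 1) :
    ∀ j ≤ k + 2, ∀ u, ⁅z j, bounce F z (k + 2) u⁆ = 0 := by
  induction k with
  | zero =>
    intro j hj u
    obtain rfl | rfl | rfl : j = 0 ∨ j = 1 ∨ j = 2 := by omega
    · exact h.sand 0 _ _
    · rw [h.bounce_two]; exact h.sand 1 _ _
    · exact h.sq 2 _
  | succ k ih =>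
    intro j hj u
    rw [bounce_apply]
    obtain hj | rfl | rfl : j ≤ k + 1 ∨ j = k + 2 ∨ j = k + 1 + 2 := by omega
    · rw [leibniz_lie, h.comm_succ (by omega) (by omega) j hj, zero_lie, zero_add,
        ih (by omega) j (by omega), lie_zero]
    · rw [bounce_apply]; exact h.sand _ _ _
    · exact h.sq _ _

theorem bounce_lie {k : ℕ} (hk : k ≤ m + 1) :
    ∀ j ≤ k + 2, ∀ u, bounce F z (k + 2) ⁅z j, u⁆ = 0 := by
  induction k with
  | zero =>
    intro j hj u
    obtain rfl | rfl | rfl : j = 0 ∨ j = 1 ∨ j = 2 := by omega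
    · rw [h.bounce_two, h.sand 0, lie_zero, lie_zero]
    · rw [bounce_apply]
      change ⁅z 2, ⁅z 0, ⁅z 1, ⁅z 2, ⁅z 1, u⁆⁆⁆⁆⁆ = 0
      rw [h.sand 1, lie_zero, lie_zero]
    · rw [bounce_apply, h.sq, map_zero, lie_zero]
  | succ k ih =>
    intro j hj u
    rw [bounce_apply]
    obtain hj | rfl | rfl : j ≤ k + 1 ∨ j = k + 2 ∨ j = k + 1 + 2 := by omega
    · rw [leibniz_lie, ← lie_skew (z (k + 1 + 2)) (z j), h.comm_succ (by omega) (by omega) j hj, neg_zero, zero_lie,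
        zero_add, ih (by omega) j (by omega), lie_zero]
    · rw [bounce_apply, h.sand, map_zero, lie_zero, lie_zero]
    · rw [h.sq, map_zero, lie_zero]

theorem mul_bounce {k : ℕ} (hk : k ≤ m + 1) {p : Module.End F L}
    (hp : p ∈ wordAlg F z (k + 2)) : ∃ c : F, p * bounce F z (k + 2) = c • bounce F z (k + 2) :=
  mul_eq_smul_of_killed (fun j hj => LinearMap.ext fun u => h.lie_bounce hk j hj u) hp

theorem bounce_mul {k : ℕ} (hk : k ≤ m + 1) {p : Module.End F L}
    (hp : p ∈ wordAlg F z (k + 2)) : ∃ c : F, bounce F z (k + 2) * p = c • bounce F z (k + 2) :=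
  mul_eq_smul_of_killed_right (fun j hj => LinearMap.ext fun u => h.bounce_lie hk j hj u) hp

/-- In two sandwiches `a`, `b` the patterns `aa` and `aba` vanish, so words have length at most 2.
-/
theorem wordAlg_one {p : Module.End F L} (hp : p ∈ wordAlg F z 1) :
    p ∈ Submodule.span F ({1, LieAlgebra.ad F L (z 0), LieAlgebra.ad F L (z 1),
      LieAlgebra.ad F L (z 0) * LieAlgebra.ad F L (z 1),
      LieAlgebra.ad F L (z 1) * LieAlgebra.ad F L (z 0)} : Set (Module.End F L)) := by
  set S := Submodule.span F ({1, LieAlgebra.ad F L (z 0), LieAlgebra.ad F L (z 1),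
      LieAlgebra.ad F L (z 0) * LieAlgebra.ad F L (z 1),
      LieAlgebra.ad F L (z 1) * LieAlgebra.ad F L (z 0)} : Set (Module.End F L)) with hS
  have hsq : ∀ j, LieAlgebra.ad F L (z j) * LieAlgebra.ad F L (z j) = 0 := fun j => by
    ext u; exact h.sq j u
  have hsand : ∀ i j, LieAlgebra.ad F L (z j) * (LieAlgebra.ad F L (z i) *
      LieAlgebra.ad F L (z j)) = 0 := fun i j => by ext u; exact h.sand j (z i) u
  refine wordAlg_induction S (Submodule.subset_span (by simp)) (fun j hj q hq => ?_) hp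
  induction hq using Submodule.span_induction with
  | mem q hq =>
    obtain rfl | rfl : j = 0 ∨ j = 1 := by omega
    · rcases hq with rfl | rfl | rfl | rfl | rfl
      · rw [mul_one]; exact Submodule.subset_span (by simp)
      · rw [hsq]; exact S.zero_mem
      · exact Submodule.subset_span (by simp)
      · rw [← mul_assoc, hsq, zero_mul]; exact S.zero_mem
      · rw [hsand]; exact S.zero_mem
    · rcases hq with rfl | rfl | rfl | rfl | rfl
      · rw [mul_one]; exact Submodule.subset_span (by simp)
      · exact Submodule.subset_span (by simp)
      · rw [hsq]; exact S.zero_mem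
      · rw [hsand]; exact S.zero_mem
      · rw [← mul_assoc, hsq, zero_mul]; exact S.zero_mem
  | zero => rw [mul_zero]; exact S.zero_mem
  | add x y _ _ hx hy => rw [mul_add]; exact S.add_mem hx hy
  | smul c x _ hx => rw [mul_smul_comm]; exact S.smul_mem c hx

/-- The decomposition of the operator algebra by the number of occurrences of the last letter,
given what can stand between two of them. -/
theorem wordAlg_succ_le_of {k : ℕ} (hk : k ≤ m + 1)
    (hb : ∀ p ∈ wordAlg F z (k + 1), ∃ c : F,
      LieAlgebra.ad F L (z (k + 2)) * p * LieAlgebra.ad F L (z (k + 2))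
        = c • bounce F z (k + 2)) :
    (wordAlg F z (k + 2)).toSubmodule ≤ (wordAlg F z (k + 1)).toSubmodule ⊔
      (wordAlg F z (k + 1)).toSubmodule * Submodule.span F {LieAlgebra.ad F L (z (k + 2))} *
        (wordAlg F z (k + 1)).toSubmodule ⊔ Submodule.span F {bounce F z (k + 2)} := by
  set A := (wordAlg F z (k + 1)).toSubmodule with hA
  set Z := LieAlgebra.ad F L (z (k + 2)) with hZ
  set S := A ⊔ A * Submodule.span F {Z} * A ⊔ Submodule.span F {bounce F z (k + 2)} with hS
  have hAS : A ≤ S := le_sup_left.trans le_sup_left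
  have hAZA : A * Submodule.span F {Z} * A ≤ S := le_sup_right.trans le_sup_left
  have hbS : bounce F z (k + 2) ∈ S := Submodule.mem_sup_right (Submodule.mem_span_singleton_self _)
  have h1A : (1 : Module.End F L) ∈ A := (wordAlg F z (k + 1)).one_mem
  have hpZq : ∀ p ∈ A, ∀ q ∈ A, p * Z * q ∈ A * Submodule.span F {Z} * A := fun p hp q hq =>
    Submodule.mul_mem_mul (Submodule.mul_mem_mul hp (Submodule.mem_span_singleton_self Z)) hq
  intro p hp
  refine wordAlg_induction S (hAS h1A) (fun j hj q hq => ?_) hp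
  have hle : S ≤ S.comap (LinearMap.mulLeft F (LieAlgebra.ad F L (z j))) := by
    refine sup_le (sup_le (fun q hq => ?_) ?_) ?_
    · rw [Submodule.mem_comap, LinearMap.mulLeft_apply]
      obtain hj | rfl : j ≤ k + 1 ∨ j = k + 2 := by omega
      · exact hAS ((wordAlg F z (k + 1)).mul_mem (ad_mem_wordAlg hj) hq)
      · have := hpZq 1 h1A q hq
        rw [one_mul] at this
        exact hAZA this
    · refine Submodule.mul_le.2 fun pz hpz q hq => ?_
      have hz : A * Submodule.span F {Z} ≤
          S.comap (LinearMap.mulLeft F (LieAlgebra.ad F L (z j)) ∘ₗ LinearMap.mulRight F q) := by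
        refine Submodule.mul_le.2 fun p hp y hy => ?_
        obtain ⟨c, rfl⟩ := Submodule.mem_span_singleton.1 hy
        rw [Submodule.mem_comap, LinearMap.comp_apply, LinearMap.mulRight_apply,
          LinearMap.mulLeft_apply, mul_smul_comm, smul_mul_assoc, mul_smul_comm]
        refine S.smul_mem c ?_
        obtain hj | rfl : j ≤ k + 1 ∨ j = k + 2 := by omega
        · have := hpZq _ ((wordAlg F z (k + 1)).mul_mem (ad_mem_wordAlg hj) hp) q hq
          rw [← mul_assoc, ← mul_assoc]
          exact hAZA this
        · obtain ⟨d, hd⟩ := hb p hp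
          obtain ⟨e, he⟩ := h.bounce_mul hk (wordAlg_mono (by omega) hq)
          rw [← mul_assoc, ← mul_assoc, ← hZ, hd, smul_mul_assoc, he]
          exact S.smul_mem _ (S.smul_mem _ hbS)
      exact hz hpz
    · rw [Submodule.span_le, Set.singleton_subset_iff]
      change LieAlgebra.ad F L (z j) * bounce F z (k + 2) ∈ S
      have : LieAlgebra.ad F L (z j) * bounce F z (k + 2) = 0 :=
        LinearMap.ext fun u => h.lie_bounce hk j hj u
      rw [this]
      exact S.zero_mem
  exact hle hq

/-- The assumption `hb` stays explicit because `ad_mul_mul_ad` establishes it by induction, using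
this lemma one letter lower. -/
theorem mem_of_mem_wordAlg_of {k : ℕ} (hk : k ≤ m + 1)
    (hb : ∀ p ∈ wordAlg F z (k + 1), ∃ c : F,
      LieAlgebra.ad F L (z (k + 2)) * p * LieAlgebra.ad F L (z (k + 2))
        = c • bounce F z (k + 2)) (S : Submodule F (Module.End F L))
    (h0 : ∀ p ∈ wordAlg F z (k + 1), p ∈ S)
    (h1 : ∀ p ∈ wordAlg F z (k + 1), ∀ q ∈ wordAlg F z (k + 1),
      p * LieAlgebra.ad F L (z (k + 2)) * q ∈ S) (h2 : bounce F z (k + 2) ∈ S)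
    {p : Module.End F L} (hp : p ∈ wordAlg F z (k + 2)) : p ∈ S := by
  have hle := h.wordAlg_succ_le_of hk hb
  refine (hle.trans (sup_le (sup_le h0 ?_) ?_)) hp
  · refine Submodule.mul_le.2 fun pz hpz q hq => ?_
    have hz : (wordAlg F z (k + 1)).toSubmodule * Submodule.span F {LieAlgebra.ad F L (z (k + 2))}
        ≤ S.comap (LinearMap.mulRight F q) := by
      refine Submodule.mul_le.2 fun p hp y hy => ?_
      obtain ⟨c, rfl⟩ := Submodule.mem_span_singleton.1 hy
      rw [Submodule.mem_comap, LinearMap.mulRight_apply, mul_smul_comm, smul_mul_assoc]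
      exact S.smul_mem c (h1 p hp q hq)
    exact hz hpz
  · rw [Submodule.span_le, Set.singleton_subset_iff]; exact h2

/-- Between two letters `z_{k+2}` only one operator can stand, up to scalars. -/
theorem ad_mul_mul_ad {k : ℕ} (hk : k ≤ m + 1) :
    ∀ p ∈ wordAlg F z (k + 1), ∃ c : F,
      LieAlgebra.ad F L (z (k + 2)) * p * LieAlgebra.ad F L (z (k + 2))
        = c • bounce F z (k + 2) := by
  induction k with
  | zero =>
    intro p hp
    have hp' := h.wordAlg_one hp
    have hle : Submodule.span F ({1, LieAlgebra.ad F L (z 0), LieAlgebra.ad F L (z 1),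
        LieAlgebra.ad F L (z 0) * LieAlgebra.ad F L (z 1),
        LieAlgebra.ad F L (z 1) * LieAlgebra.ad F L (z 0)} : Set (Module.End F L)) ≤
        (Submodule.span F {bounce F z 2}).comap
        (LinearMap.mulLeft F (LieAlgebra.ad F L (z 2)) ∘ₗ
          LinearMap.mulRight F (LieAlgebra.ad F L (z 2))) := by
      rw [Submodule.span_le]
      intro q hq
      rw [SetLike.mem_coe, Submodule.mem_comap, LinearMap.comp_apply, LinearMap.mulRight_apply,
        LinearMap.mulLeft_apply]
      rcases hq with rfl | rfl | rfl | rfl | rfl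
      · have : LieAlgebra.ad F L (z 2) * (1 * LieAlgebra.ad F L (z 2)) = 0 := by
          ext u; exact h.sq 2 u
        rw [this]; exact Submodule.zero_mem _
      · have : LieAlgebra.ad F L (z 2) * (LieAlgebra.ad F L (z 0) * LieAlgebra.ad F L (z 2)) = 0 := by
          ext u; exact h.sand 2 _ u
        rw [this]; exact Submodule.zero_mem _
      · have : LieAlgebra.ad F L (z 2) * (LieAlgebra.ad F L (z 1) * LieAlgebra.ad F L (z 2)) = 0 := by
          ext u; exact h.sand 2 _ u
        rw [this]; exact Submodule.zero_mem _
      · exact Submodule.mem_span_singleton_self _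
      · have : LieAlgebra.ad F L (z 2) * (LieAlgebra.ad F L (z 1) * LieAlgebra.ad F L (z 0) *
            LieAlgebra.ad F L (z 2)) = bounce F z 2 := by
          ext u; exact (h.bounce_two u).symm
        rw [this]; exact Submodule.mem_span_singleton_self _
    obtain ⟨c, hc⟩ := Submodule.mem_span_singleton.1 (hle hp')
    exact ⟨c, by rw [hc, mul_assoc]; rfl⟩
  | succ k ih =>
    intro p hp
    have hcomm := h.comm_succ (k := k + 1) (by omega) (by omega)
    set Y := LieAlgebra.ad F L (z (k + 1 + 2)) with hY
    have hYp : ∀ p ∈ wordAlg F z (k + 1), p * Y = Y * p := fun p hp =>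
      LinearMap.ext fun u => wordAlg_apply_lie hcomm hp u
    have hYY : Y * Y = 0 := LinearMap.ext fun u => h.sq _ u
    -- Split `p` by its letter `Z = ad z_{k+2}`. Words in lower letters commute with `Y`, so the
    -- first two cases contain `YY` or `YZY`; the third is the next bounce.
    have : p ∈ (Submodule.span F {bounce F z (k + 1 + 2)}).comap
        (LinearMap.mulLeft F Y ∘ₗ LinearMap.mulRight F Y) := by
      refine h.mem_of_mem_wordAlg_of (by omega) (ih (by omega)) _ (fun p hp => ?_)
        (fun p hp q hq => ?_) ?_ hp
      · rw [Submodule.mem_comap, LinearMap.comp_apply, LinearMap.mulRight_apply,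
          LinearMap.mulLeft_apply, hYp p hp, ← mul_assoc, hYY, zero_mul]
        exact Submodule.zero_mem _
      · rw [Submodule.mem_comap, LinearMap.comp_apply, LinearMap.mulRight_apply,
          LinearMap.mulLeft_apply, mul_assoc _ q, hYp q hq]
        have : Y * (p * LieAlgebra.ad F L (z (k + 2)) * (Y * q))
            = p * (Y * LieAlgebra.ad F L (z (k + 2)) * Y) * q := by
          simp only [← mul_assoc, hYp p hp]
        rw [this, op_comp_eq_zero (h.sand _), mul_zero, zero_mul]
        exact Submodule.zero_mem _
      · exact Submodule.mem_span_singleton_self _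
    obtain ⟨c, hc⟩ := Submodule.mem_span_singleton.1 this
    exact ⟨c, by rw [hc, mul_assoc]; rfl⟩

/-- To check a linear condition on the words in `z₀, …, z_{k+2}`, it is enough to consider words
with at most one letter `z_{k+2}` and the word `bounce (k + 2)`. -/
theorem mem_of_mem_wordAlg {k : ℕ} (hk : k ≤ m + 1) (S : Submodule F (Module.End F L))
    (h0 : ∀ p ∈ wordAlg F z (k + 1), p ∈ S)
    (h1 : ∀ p ∈ wordAlg F z (k + 1), ∀ q ∈ wordAlg F z (k + 1),
      p * LieAlgebra.ad F L (z (k + 2)) * q ∈ S) (h2 : bounce F z (k + 2) ∈ S)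
    {p : Module.End F L} (hp : p ∈ wordAlg F z (k + 2)) : p ∈ S :=
  h.mem_of_mem_wordAlg_of hk (h.ad_mul_mul_ad hk) S h0 h1 h2 hp

theorem wordAlg_fg {k : ℕ} (hk : k ≤ m + 2) : (wordAlg F z (k + 1)).toSubmodule.FG := by
  have key : ∀ {S T : Submodule F (Module.End F L)}, S ≤ T → T.FG → S.FG := by
    intro S T hST hT
    have := isNoetherian_of_fg_of_noetherian T hT
    exact isNoetherian_submodule.1 this S hST
  induction k with
  | zero => exact key (fun p hp => h.wordAlg_one hp) (Submodule.fg_span (Set.toFinite _))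
  | succ k ih =>
    have ih := ih (by omega)
    exact key (h.wordAlg_succ_le_of (by omega) (h.ad_mul_mul_ad (by omega)))
      ((ih.sup ((ih.mul (Submodule.fg_span_singleton _)).mul ih)).sup
        (Submodule.fg_span_singleton _))

end IsSandwichFamily

end Sandwich

section Sandwich

variable {F L : Type*} [Field F] [LieRing L] [LieAlgebra F L]

variable (F) in
/-- The span of two elements that are killed by all generators of a sandwich family. -/
def tailSpan (m : ℕ) (z : ℕ → L) : Submodule F L :=
  Submodule.span F {⁅z (m + 4), bounce F z (m + 2) ⁅z (m + 3), z (m + 4)⁆⁆,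
    ⁅z (m + 4), ⁅z (m + 3), bounce F z (m + 2) (z (m + 4))⁆⁆}

theorem bounce_apply_lie {z : ℕ → L} {i k : ℕ} (hi : ∀ j ≤ k + 1, ⁅z j, z i⁆ = 0) (u : L) :
    bounce F z (k + 1) ⁅z i, u⁆ = ⁅z i, bounce F z (k + 1) u⁆ :=
  wordAlg_apply_lie hi (bounce_mem_wordAlg _) u

namespace IsSandwichFamily

variable {z : ℕ → L} {m : ℕ} (h : IsSandwichFamily F m z)
include h

/-! ### Spanning sets of the Lie algebra -/

theorem lie_lie_self (j : ℕ) (u : L) : ⁅z j, ⁅u, z j⁆⁆ = 0 := by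
  rw [← lie_skew u (z j), lie_neg, h.sq, neg_zero]

/-- An element `z_i` that commutes with all letters below `z_{k+2}` kills its multiples by words
in the letters up to `z_{k+2}`. -/
theorem lie_wordAlg_apply {i k : ℕ} (hk : k ≤ m + 1) (hi : ∀ j ≤ k + 1, ⁅z j, z i⁆ = 0)
    {p : Module.End F L} (hp : p ∈ wordAlg F z (k + 2)) : ⁅z i, p (z i)⁆ = 0 := by
  refine h.mem_of_mem_wordAlg hk (LinearMap.ker
    ((LieAlgebra.ad F L (z i) : L →ₗ[F] L) ∘ₗ LinearMap.applyₗ (z i)))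
    (fun p hp => ?_) (fun p hp q hq => ?_) ?_ hp
  · obtain ⟨c, hc⟩ := wordAlg_apply_of_killed hi hp
    change ⁅z i, p (z i)⁆ = 0
    rw [hc, lie_smul, lie_self, smul_zero]
  · obtain ⟨c, hc⟩ := wordAlg_apply_of_killed hi hq
    change ⁅z i, p ⁅z (k + 2), q (z i)⁆⁆ = 0
    rw [hc, lie_smul, map_smul, lie_smul, ← wordAlg_apply_lie hi hp, h.lie_lie_self,
      map_zero, smul_zero]
  · change ⁅z i, bounce F z (k + 2) (z i)⁆ = 0
    rw [bounce_apply, ← lie_skew (z (k + 2)) (z i), map_neg, bounce_apply_lie hi, lie_neg, lie_neg, h.sand,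
      neg_zero]

/-- Separate treatment of `k = 0` is forced by the triangle: `z_2` commutes neither with `z_0` nor
with `z_1`. Beyond it, `z_{k+2}` commutes with all letters up to `z_k`. -/
theorem lie_wordAlg_apply_self {k : ℕ} (hk : k ≤ m + 1) {p : Module.End F L}
    (hp : p ∈ wordAlg F z (k + 1)) : ⁅z (k + 2), p (z (k + 2))⁆ = 0 := by
  cases k with
  | zero =>
    have hle : Submodule.span F ({1, LieAlgebra.ad F L (z 0), LieAlgebra.ad F L (z 1),
        LieAlgebra.ad F L (z 0) * LieAlgebra.ad F L (z 1),
        LieAlgebra.ad F L (z 1) * LieAlgebra.ad F L (z 0)} : Set (Module.End F L)) ≤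
        LinearMap.ker ((LieAlgebra.ad F L (z 2) : L →ₗ[F] L) ∘ₗ LinearMap.applyₗ (z 2)) := by
      rw [Submodule.span_le]
      rintro q (rfl | rfl | rfl | rfl | rfl)
      · exact lie_self _
      · exact h.lie_lie_self 2 _
      · exact h.lie_lie_self 2 _
      · exact sandwich_self (h.sand 2) _ _
      · exact sandwich_self (h.sand 2) _ _
    exact hle (h.wordAlg_one hp)
  | succ k => exact h.lie_wordAlg_apply (by omega) (h.comm_succ (by omega) (by omega)) hp

theorem partAlg_one_le : (partAlg F z 1).toSubmodule ≤
    Submodule.span F ({z 0, z 1, ⁅z 0, z 1⁆} : Set L) := by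
  intro u hu
  refine partAlg_induction (Submodule.span F ({z 0, z 1, ⁅z 0, z 1⁆} : Set L)) (fun j hj => ?_) (fun j hj v hv => ?_) hu
  · obtain rfl | rfl : j = 0 ∨ j = 1 := by omega
    all_goals exact Submodule.subset_span (by simp)
  · induction hv using Submodule.span_induction with
    | mem v hv =>
      obtain rfl | rfl : j = 0 ∨ j = 1 := by omega
      · rcases hv with rfl | rfl | rfl
        · rw [lie_self]; exact Submodule.zero_mem _
        · exact Submodule.subset_span (by simp)
        · rw [h.sq]; exact Submodule.zero_mem _
      · rcases hv with rfl | rfl | rfl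
        · rw [← lie_skew (z 1) (z 0)]
          refine Submodule.neg_mem _ ?_
          exact Submodule.subset_span (by simp)
        · rw [lie_self]; exact Submodule.zero_mem _
        · rw [h.lie_lie_self]; exact Submodule.zero_mem _
    | zero => rw [lie_zero]; exact Submodule.zero_mem _
    | add x y _ _ hx hy => rw [lie_add]; exact Submodule.add_mem _ hx hy
    | smul c x _ hx => rw [lie_smul]; exact Submodule.smul_mem _ c hx

/-- Bracketing with `z_{k+2}` a second time gives zero by `lie_wordAlg_apply_self`, so at most one
occurrence of `z_{k+2}` is needed. -/
theorem partAlg_succ_le {k : ℕ} (hk : k ≤ m + 1) : (partAlg F z (k + 2)).toSubmodule ≤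
    (partAlg F z (k + 1)).toSubmodule ⊔
      (wordAlg F z (k + 1)).toSubmodule.map (LinearMap.applyₗ (z (k + 2))) := by
  set S := (partAlg F z (k + 1)).toSubmodule ⊔
    (wordAlg F z (k + 1)).toSubmodule.map (LinearMap.applyₗ (z (k + 2))) with hS
  have hS1 : ∀ u ∈ partAlg F z (k + 1), u ∈ S := fun u hu => Submodule.mem_sup_left hu
  have hS2 : ∀ p ∈ wordAlg F z (k + 1), p (z (k + 2)) ∈ S := fun p hp =>
    Submodule.mem_sup_right ⟨p, hp, rfl⟩
  intro u hu
  refine partAlg_induction S (fun j hj => ?_) (fun j hj v hv => ?_) hu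
  · obtain hj | rfl : j ≤ k + 1 ∨ j = k + 2 := by omega
    · exact hS1 _ (mem_partAlg hj)
    · exact hS2 1 (Subalgebra.one_mem _)
  · have hle : S ≤ S.comap (LieAlgebra.ad F L (z j) : L →ₗ[F] L) := by
      refine sup_le (fun v hv => ?_) ?_
      · change ⁅z j, v⁆ ∈ S
        obtain hj | rfl : j ≤ k + 1 ∨ j = k + 2 := by omega
        · exact hS1 _ ((partAlg F z (k + 1)).lie_mem (mem_partAlg hj) hv)
        · rw [← lie_skew]
          exact S.neg_mem (hS2 _ (ad_mem_wordAlg_of_mem_partAlg hv))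
      · rintro _ ⟨p, hp, rfl⟩
        change ⁅z j, p (z (k + 2))⁆ ∈ S
        obtain hj | rfl : j ≤ k + 1 ∨ j = k + 2 := by omega
        · exact hS2 _ (Subalgebra.mul_mem _ (ad_mem_wordAlg hj) hp)
        · rw [h.lie_wordAlg_apply_self hk hp]; exact S.zero_mem
    exact hle hv

theorem partAlg_fg {k : ℕ} (hk : k ≤ m + 2) : (partAlg F z (k + 1)).toSubmodule.FG := by
  have key : ∀ {S T : Submodule F L}, S ≤ T → T.FG → S.FG := by
    intro S T hST hT
    have := isNoetherian_of_fg_of_noetherian T hT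
    exact isNoetherian_submodule.1 this S hST
  induction k with
  | zero => exact key h.partAlg_one_le (Submodule.fg_span (Set.toFinite _))
  | succ k ih =>
    exact key (h.partAlg_succ_le (by omega)) ((ih (by omega)).sup
      ((h.wordAlg_fg (by omega)).map _))

theorem comm_prev : ∀ j ≤ m + 1, ⁅z j, z (m + 3)⁆ = 0 := h.comm_succ (by omega) le_rfl

/-- Letters up to `z_{m+1}` pass `z_{m+3}` and `z_{m+4}` and are killed at the bounce. The three
letters of the last triangle produce sandwich patterns. -/
theorem lie_tailSpan {u : L} (hu : u ∈ tailSpan F m z) : ∀ j ≤ m + 4, ⁅z j, u⁆ = 0 := by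
  intro j hj
  have ha := h.comm_last
  have hb := h.comm_prev
  have key : tailSpan F m z ≤ LinearMap.ker (LieAlgebra.ad F L (z j) : L →ₗ[F] L) := by
    rw [tailSpan, Submodule.span_le]
    rintro _ (rfl | rfl)
    · change ⁅z j, ⁅z (m + 4), bounce F z (m + 2) ⁅z (m + 3), z (m + 4)⁆⁆⁆ = 0
      obtain hj | rfl | rfl | rfl : j ≤ m + 1 ∨ j = m + 2 ∨ j = m + 3 ∨ j = m + 4 := by omega
      · rw [leibniz_lie, ha j hj, zero_lie, zero_add, h.lie_bounce (by omega) j (by omega),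
          lie_zero]
      · rw [bounce_apply, h.sand]
      · rw [← lie_skew (z (m + 3)) (z (m + 4)), map_neg, lie_neg, lie_neg, neg_eq_zero, bounce_apply,
          sandwich_bounce (h.sand _) (h.sand _) (bounce_apply_lie hb) (bounce_apply_lie ha)]
      · exact h.sq _ _
    · change ⁅z j, ⁅z (m + 4), ⁅z (m + 3), bounce F z (m + 2) (z (m + 4))⁆⁆⁆ = 0
      obtain hj | rfl | rfl | rfl : j ≤ m + 1 ∨ j = m + 2 ∨ j = m + 3 ∨ j = m + 4 := by omega
      · rw [leibniz_lie, ha j hj, zero_lie, zero_add, leibniz_lie (z j) (z (m + 3)), hb j hj,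
          zero_lie, zero_add, h.lie_bounce (by omega) j (by omega), lie_zero, lie_zero]
      · rw [bounce_apply, ← lie_skew (z (m + 2)) (z (m + 4)), map_neg, bounce_apply_lie ha]
        simp only [lie_neg]
        rw [sandwich_swap (h.sand (m + 4)), h.sand, neg_zero]
      · exact h.sand _ _ _
      · exact h.sq _ _
  exact key hu

theorem wordAlg_apply_mem_tailSpan {p : Module.End F L} (hp : p ∈ wordAlg F z (m + 4)) {u : L}
    (hu : u ∈ tailSpan F m z) : p u ∈ tailSpan F m z := by
  obtain ⟨c, hc⟩ := wordAlg_apply_of_killed (h.lie_tailSpan hu) hp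
  rw [hc]
  exact Submodule.smul_mem _ c hu

/-- Words in `z₀, …, z_{m+2}` applied to `z_{m+4}`. -/
theorem wordAlg_apply_last (S : Submodule F L) (h0 : z (m + 4) ∈ S)
    (h1 : ∀ r ∈ wordAlg F z (m + 1), r ⁅z (m + 2), z (m + 4)⁆ ∈ S)
    (h2 : bounce F z (m + 2) (z (m + 4)) ∈ S) {p : Module.End F L}
    (hp : p ∈ wordAlg F z (m + 2)) : p (z (m + 4)) ∈ S := by
  refine h.mem_of_mem_wordAlg (by omega) (S.comap (LinearMap.applyₗ (z (m + 4))))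
    (fun p hp => ?_) (fun p hp q hq => ?_) h2 hp
  · obtain ⟨c, hc⟩ := wordAlg_apply_of_killed h.comm_last hp
    change p (z (m + 4)) ∈ S
    rw [hc]; exact S.smul_mem c h0
  · obtain ⟨c, hc⟩ := wordAlg_apply_of_killed h.comm_last hq
    change p ⁅z (m + 2), q (z (m + 4))⁆ ∈ S
    rw [hc, lie_smul, map_smul]
    exact S.smul_mem c (h1 p hp)

theorem lie_lie_eq_zero_of_le {j : ℕ} (hj : j ≤ m + 1) : ⁅z j, ⁅z (m + 3), z (m + 4)⁆⁆ = 0 := by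
  rw [leibniz_lie, h.comm_prev j hj, h.comm_last j hj, zero_lie, lie_zero, add_zero]

theorem lie_bounce_lie (u : L) :
    ⁅z (m + 2), ⁅z (m + 3), bounce F z (m + 2) u⁆⁆ = 0 := by
  rw [bounce_apply, h.sand]

theorem bounce_lie_lie (u : L) :
    bounce F z (m + 2) ⁅z (m + 3), ⁅z (m + 2), u⁆⁆ = 0 := by
  rw [bounce_apply, h.sand, map_zero, lie_zero]

theorem bounce_lie_bounce (u : L) :
    bounce F z (m + 2) ⁅z (m + 3), bounce F z (m + 2) u⁆ = 0 := by
  rw [bounce_apply m u, h.bounce_lie_lie]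

/-- At the last triangle a second `z_{m+4}` need not kill. Splitting `p` by its letters `z_{m+3}`,
and the pieces by `z_{m+2}`, every word either contains a sandwich pattern or reduces to one of the
two elements spanning `tailSpan`. -/
theorem last_lie_wordAlg_apply {p : Module.End F L} (hp : p ∈ wordAlg F z (m + 3)) :
    ⁅z (m + 4), p (z (m + 4))⁆ ∈ tailSpan F m z := by
  have ha := h.comm_last
  have hb := h.comm_prev
  have hR1 : ⁅z (m + 4), bounce F z (m + 2) ⁅z (m + 3), z (m + 4)⁆⁆ ∈ tailSpan F m z :=
    Submodule.subset_span (by simp)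
  have hR2 : ⁅z (m + 4), ⁅z (m + 3), bounce F z (m + 2) (z (m + 4))⁆⁆ ∈ tailSpan F m z :=
    Submodule.subset_span (by simp)
  refine h.mem_of_mem_wordAlg le_rfl ((tailSpan F m z).comap
    ((LieAlgebra.ad F L (z (m + 4)) : L →ₗ[F] L) ∘ₗ LinearMap.applyₗ (z (m + 4))))
    (fun p hp => ?_) (fun p hp q hq => ?_) ?_ hp
  · change ⁅z (m + 4), p (z (m + 4))⁆ ∈ tailSpan F m z
    rw [h.lie_wordAlg_apply (by omega) ha hp]
    exact Submodule.zero_mem _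
  · change ⁅z (m + 4), p ⁅z (m + 3), q (z (m + 4))⁆⁆ ∈ tailSpan F m z
    refine h.wordAlg_apply_last ((tailSpan F m z).comap
      ((LieAlgebra.ad F L (z (m + 4)) : L →ₗ[F] L) ∘ₗ p ∘ₗ
        (LieAlgebra.ad F L (z (m + 3)) : L →ₗ[F] L))) ?_ (fun r hr => ?_) ?_ hq
    · change ⁅z (m + 4), p ⁅z (m + 3), z (m + 4)⁆⁆ ∈ tailSpan F m z
      refine h.mem_of_mem_wordAlg (by omega) ((tailSpan F m z).comap
        ((LieAlgebra.ad F L (z (m + 4)) : L →ₗ[F] L) ∘ₗ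
          LinearMap.applyₗ ⁅z (m + 3), z (m + 4)⁆)) (fun p hp => ?_) (fun p hp q hq => ?_) hR1 hp
      · change ⁅z (m + 4), p ⁅z (m + 3), z (m + 4)⁆⁆ ∈ tailSpan F m z
        rw [← wordAlg_apply_lie ha hp, h.lie_lie_self, map_zero]
        exact Submodule.zero_mem _
      · change ⁅z (m + 4), p ⁅z (m + 2), q ⁅z (m + 3), z (m + 4)⁆⁆⁆ ∈ tailSpan F m z
        obtain ⟨c, hc⟩ := wordAlg_apply_of_killed (fun j hj => h.lie_lie_eq_zero_of_le hj) hq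
        rw [hc, lie_smul, map_smul, lie_smul, ← wordAlg_apply_lie ha hp,
          sandwich_self (h.sand _), map_zero, smul_zero]
        exact Submodule.zero_mem _
    · change ⁅z (m + 4), p ⁅z (m + 3), r ⁅z (m + 2), z (m + 4)⁆⁆⁆ ∈ tailSpan F m z
      rw [← wordAlg_apply_lie hb hr]
      refine h.mem_of_mem_wordAlg (by omega) ((tailSpan F m z).comap
        ((LieAlgebra.ad F L (z (m + 4)) : L →ₗ[F] L) ∘ₗ
          LinearMap.applyₗ (r ⁅z (m + 3), ⁅z (m + 2), z (m + 4)⁆⁆)))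
        (fun p hp => ?_) (fun p hp q hq => ?_) ?_ hp
      · change ⁅z (m + 4), p (r ⁅z (m + 3), ⁅z (m + 2), z (m + 4)⁆⁆)⁆ ∈ tailSpan F m z
        rw [← wordAlg_apply_lie ha hp, ← wordAlg_apply_lie ha hr, sandwich_self (h.sand _),
          map_zero, map_zero]
        exact Submodule.zero_mem _
      · change ⁅z (m + 4), p ⁅z (m + 2), (q * r) ⁅z (m + 3), ⁅z (m + 2), z (m + 4)⁆⁆⁆⁆ ∈ tailSpan F m z
        have hqr := Subalgebra.mul_mem _ hq hr
        rw [← wordAlg_apply_lie ha hp]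
        refine h.wordAlg_apply_mem_tailSpan (wordAlg_mono (by omega) hp) ?_
        obtain ⟨c, hc⟩ := h.ad_mul_mul_ad (by omega) _ hqr
        have hc' : ⁅z (m + 2), (q * r) ⁅z (m + 2), z (m + 4)⁆⁆
            = c • bounce F z (m + 2) (z (m + 4)) := LinearMap.congr_fun hc (z (m + 4))
        -- Turning `[z_{m+2}, z_{m+4}]` around lets `z_{m+4}` move left, so that `z_{m+2}` and
        -- `z_{m+3}` can be swapped between two `z_{m+4}`. After moving back, `z_{m+2} (q r)
        -- z_{m+2}` is a multiple of the bounce.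
        rw [← lie_skew (z (m + 2)) (z (m + 4)), lie_neg, map_neg, wordAlg_apply_lie hb hqr,
          wordAlg_apply_lie ha hqr, lie_neg, lie_neg, sandwich_swap (h.sand (m + 4)),
          ← wordAlg_apply_lie ha hqr, ← lie_neg, ← lie_neg, ← lie_neg, ← map_neg, lie_skew, hc',
          lie_smul, lie_smul]
        exact Submodule.smul_mem _ c hR2
      · change ⁅z (m + 4), bounce F z (m + 2) (r ⁅z (m + 3), ⁅z (m + 2), z (m + 4)⁆⁆)⁆ ∈ tailSpan F m z
        obtain ⟨c, hc⟩ := h.bounce_mul (k := m) (by omega) (wordAlg_mono (by omega) hr)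
        have := LinearMap.congr_fun hc ⁅z (m + 3), ⁅z (m + 2), z (m + 4)⁆⁆
        rw [Module.End.mul_apply, LinearMap.smul_apply, h.bounce_lie_lie, smul_zero] at this
        rw [this, lie_zero]
        exact Submodule.zero_mem _
    · change ⁅z (m + 4), p ⁅z (m + 3), bounce F z (m + 2) (z (m + 4))⁆⁆ ∈ tailSpan F m z
      refine h.mem_of_mem_wordAlg (by omega) ((tailSpan F m z).comap
        ((LieAlgebra.ad F L (z (m + 4)) : L →ₗ[F] L) ∘ₗ
          LinearMap.applyₗ ⁅z (m + 3), bounce F z (m + 2) (z (m + 4))⁆))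
        (fun p hp => ?_) (fun p hp q hq => ?_) ?_ hp
      · change ⁅z (m + 4), p ⁅z (m + 3), bounce F z (m + 2) (z (m + 4))⁆⁆ ∈ tailSpan F m z
        rw [← wordAlg_apply_lie ha hp]
        exact h.wordAlg_apply_mem_tailSpan (wordAlg_mono (by omega) hp) hR2
      · change ⁅z (m + 4), p ⁅z (m + 2), q ⁅z (m + 3), bounce F z (m + 2) (z (m + 4))⁆⁆⁆ ∈ tailSpan F m z
        obtain ⟨c, hc⟩ := h.mul_bounce (k := m) (by omega) (wordAlg_mono (by omega) hq)
        have := LinearMap.congr_fun hc (z (m + 4))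
        rw [Module.End.mul_apply, LinearMap.smul_apply] at this
        rw [wordAlg_apply_lie hb hq, this, lie_smul, lie_smul, h.lie_bounce_lie, smul_zero,
          map_zero, lie_zero]
        exact Submodule.zero_mem _
      · change ⁅z (m + 4), bounce F z (m + 2) ⁅z (m + 3), bounce F z (m + 2) (z (m + 4))⁆⁆ ∈ tailSpan F m z
        rw [h.bounce_lie_bounce, lie_zero]
        exact Submodule.zero_mem _
  · change ⁅z (m + 4), bounce F z (m + 3) (z (m + 4))⁆ ∈ tailSpan F m z
    rw [bounce_apply, bounce_apply, sandwich_bounce (h.sand _) (h.sand _)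
      (bounce_apply_lie ha) (bounce_apply_lie hb)]
    exact Submodule.zero_mem _

/-- Zero, one or two occurrences of `z_{m+4}`; a third cannot occur, since `tailSpan` is killed by
all generators. -/
theorem sup_eq_top : (partAlg F z (m + 3)).toSubmodule ⊔
    (wordAlg F z (m + 3)).toSubmodule.map (LinearMap.applyₗ (z (m + 4))) ⊔ tailSpan F m z = ⊤ := by
  set S := (partAlg F z (m + 3)).toSubmodule ⊔
    (wordAlg F z (m + 3)).toSubmodule.map (LinearMap.applyₗ (z (m + 4))) ⊔ tailSpan F m z with hS
  have hS1 : ∀ u ∈ partAlg F z (m + 3), u ∈ S := fun u hu =>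
    Submodule.mem_sup_left (Submodule.mem_sup_left hu)
  have hS2 : ∀ p ∈ wordAlg F z (m + 3), p (z (m + 4)) ∈ S := fun p hp =>
    Submodule.mem_sup_left (Submodule.mem_sup_right ⟨p, hp, rfl⟩)
  refine submodule_eq_top_of_lieSpan_eq_top h.lieSpan_eq S ?_ ?_
  · rintro _ ⟨j, hj, rfl⟩
    rw [Set.mem_Iic] at hj
    obtain hj | rfl : j ≤ m + 3 ∨ j = m + 4 := by omega
    · exact hS1 _ (mem_partAlg hj)
    · exact hS2 1 (Subalgebra.one_mem _)
  · rintro _ ⟨j, hj, rfl⟩ v hv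
    rw [Set.mem_Iic] at hj
    have hle : S ≤ S.comap (LieAlgebra.ad F L (z j) : L →ₗ[F] L) := by
      refine sup_le (sup_le (fun v hv => ?_) ?_) fun v hv => ?_
      · change ⁅z j, v⁆ ∈ S
        obtain hj | rfl : j ≤ m + 3 ∨ j = m + 4 := by omega
        · exact hS1 _ ((partAlg F z (m + 3)).lie_mem (mem_partAlg hj) hv)
        · rw [← lie_skew]
          exact S.neg_mem (hS2 _ (ad_mem_wordAlg_of_mem_partAlg hv))
      · rintro _ ⟨p, hp, rfl⟩
        change ⁅z j, p (z (m + 4))⁆ ∈ S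
        obtain hj | rfl : j ≤ m + 3 ∨ j = m + 4 := by omega
        · exact hS2 _ (Subalgebra.mul_mem _ (ad_mem_wordAlg hj) hp)
        · exact Submodule.mem_sup_right (h.last_lie_wordAlg_apply hp)
      · change ⁅z j, v⁆ ∈ S
        rw [h.lie_tailSpan hv j hj]
        exact S.zero_mem
    exact hle hv

theorem finite : Module.Finite F L := by
  refine ⟨?_⟩
  rw [← h.sup_eq_top]
  exact ((h.partAlg_fg le_rfl).sup ((h.wordAlg_fg le_rfl).map _)).sup
    (Submodule.fg_span (Set.toFinite _))

end IsSandwichFamily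

end Sandwich

/-! ### Vanishing of invariant forms on sandwich algebras -/

section Forms

variable {F L : Type*} [Field F] [LieRing L] [LieAlgebra F L]

namespace IsInvariantForm

variable {γ : LinearMap.BilinForm F L} (hγ : IsInvariantForm γ)
include hγ

theorem lie_self_right (x u : L) : γ x ⁅x, u⁆ = 0 := by
  rw [hγ.assoc, lie_self, map_zero, LinearMap.zero_apply]

theorem apply_lie_self (x u : L) : γ x ⁅u, x⁆ = 0 := by
  rw [← lie_skew u x, map_neg, hγ.lie_self_right, neg_zero]

theorem apply_lie_lie {x : L} (hx : ∀ y : L, ⁅x, ⁅x, y⁆⁆ = 0) (y u : L) :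
    γ x ⁅y, ⁅x, u⁆⁆ = 0 := by
  rw [hγ.assoc, hγ.assoc, ← lie_skew, hx, neg_zero, map_zero, LinearMap.zero_apply]

theorem apply_lie_lie_lie {x : L} (hx : ∀ y u : L, ⁅x, ⁅y, ⁅x, u⁆⁆⁆ = 0) (y w u : L) :
    γ x ⁅y, ⁅w, ⁅x, u⁆⁆⁆ = 0 := by
  have h1 : ⁅⁅⁅x, y⁆, w⁆, x⁆ = 0 := by
    rw [← lie_skew, ← lie_skew ⁅x, y⁆ w, lie_neg, neg_neg, hx]
  rw [hγ.assoc, hγ.assoc, hγ.assoc, h1, map_zero, LinearMap.zero_apply]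

theorem apply_eq_zero_of_lie_eq_zero {x y : L} (hxy : ⁅x, y⁆ = 0) (u : L) : γ y ⁅x, u⁆ = 0 := by
  rw [hγ.assoc, ← lie_skew, hxy, neg_zero, map_zero, LinearMap.zero_apply]

/-- Dual to the action on killed elements: by invariance a letter moves over to `y`, where it gives
zero. -/
theorem apply_wordAlg_of_killed {z : ℕ → L} {k : ℕ} {y : L} (hy : ∀ j ≤ k, ⁅z j, y⁆ = 0)
    {p : Module.End F L} (hp : p ∈ wordAlg F z k) : ∃ c : F, ∀ u, γ y (p u) = c * γ y u := by
  induction hp using Algebra.adjoin_induction with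
  | mem x hx =>
    obtain ⟨j, hj, rfl⟩ := hx
    exact ⟨0, fun u => by
      rw [LieAlgebra.ad_apply, hγ.apply_eq_zero_of_lie_eq_zero (hy j hj), zero_mul]⟩
  | algebraMap r => exact ⟨r, fun u => by simp [Algebra.algebraMap_eq_smul_one]⟩
  | add p q _ _ hp hq =>
    obtain ⟨c, hc⟩ := hp
    obtain ⟨d, hd⟩ := hq
    exact ⟨c + d, fun u => by rw [LinearMap.add_apply, map_add, hc, hd, add_mul]⟩
  | mul p q _ _ hp hq =>
    obtain ⟨c, hc⟩ := hp
    obtain ⟨d, hd⟩ := hq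
    exact ⟨c * d, fun u => by rw [Module.End.mul_apply, hc, hd, mul_assoc]⟩

/-- Letters are skew for the form, so the adjoint of a word is the reversed word up to sign. -/
theorem exists_adjoint {z : ℕ → L} {k : ℕ} {p : Module.End F L} (hp : p ∈ wordAlg F z k) :
    ∃ q ∈ wordAlg F z k, ∀ u v, γ u (p v) = γ (q u) v := by
  induction hp using Algebra.adjoin_induction with
  | mem x hx =>
    obtain ⟨j, hj, rfl⟩ := hx
    exact ⟨-LieAlgebra.ad F L (z j), Subalgebra.neg_mem _ (ad_mem_wordAlg hj), fun u v => by
      rw [LinearMap.neg_apply, LieAlgebra.ad_apply, LieAlgebra.ad_apply, lie_skew, hγ.assoc]⟩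
  | algebraMap r =>
    exact ⟨_, Subalgebra.algebraMap_mem _ r, fun u v => by simp [Algebra.algebraMap_eq_smul_one]⟩
  | add p q _ _ hp hq =>
    obtain ⟨p', hp', h1⟩ := hp
    obtain ⟨q', hq', h2⟩ := hq
    exact ⟨p' + q', Subalgebra.add_mem _ hp' hq', fun u v => by
      rw [LinearMap.add_apply, LinearMap.add_apply, map_add, map_add, LinearMap.add_apply, h1, h2]⟩
  | mul p q _ _ hp hq =>
    obtain ⟨p', hp', h1⟩ := hp
    obtain ⟨q', hq', h2⟩ := hq
    exact ⟨q' * p', Subalgebra.mul_mem _ hq' hp', fun u v => by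
      rw [Module.End.mul_apply, Module.End.mul_apply, h1, h2]⟩

end IsInvariantForm

namespace IsSandwichFamily

/-! ### Invariant forms on the sandwich algebra -/

variable {z : ℕ → L} {m : ℕ} (h : IsSandwichFamily F m z) {γ : LinearMap.BilinForm F L}
  (hγ : IsInvariantForm γ) (hpair : ∀ i j, γ (z i) (z j) = 0)
include h hγ hpair

/-- Letters up to `z_{k+1}` act by zero from either side. What is left is `γ(z_i, z_i)`, `γ(z_i,
[z_{k+2}, z_i])` and a bounce in which the right-hand `z_i` moves left until only `z_{k+2}`
separates it from the other. -/
theorem form_wordAlg_apply {i k : ℕ} (hk : k ≤ m + 1) (hi : ∀ j ≤ k + 1, ⁅z j, z i⁆ = 0)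
    {p : Module.End F L} (hp : p ∈ wordAlg F z (k + 2)) : γ (z i) (p (z i)) = 0 := by
  refine h.mem_of_mem_wordAlg hk (LinearMap.ker ((γ (z i) : L →ₗ[F] F) ∘ₗ LinearMap.applyₗ (z i)))
    (fun p hp => ?_) (fun p hp q hq => ?_) ?_ hp
  · obtain ⟨c, hc⟩ := wordAlg_apply_of_killed hi hp
    change γ (z i) (p (z i)) = 0
    rw [hc, map_smul, hpair, smul_zero]
  · obtain ⟨c, hc⟩ := wordAlg_apply_of_killed hi hq
    obtain ⟨d, hd⟩ := hγ.apply_wordAlg_of_killed hi hp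
    change γ (z i) (p ⁅z (k + 2), q (z i)⁆) = 0
    rw [hd, hc, lie_smul, map_smul, hγ.apply_lie_self, smul_zero, mul_zero]
  · change γ (z i) (bounce F z (k + 2) (z i)) = 0
    rw [bounce_apply, ← lie_skew (z (k + 2)) (z i), map_neg, bounce_apply_lie hi, lie_neg, map_neg,
      hγ.apply_lie_lie (h.sq i), neg_zero]

theorem form_partAlg {i k : ℕ} (hk : k ≤ m + 1) (hi : ∀ j ≤ k + 1, ⁅z j, z i⁆ = 0)
    {u : L} (hu : u ∈ partAlg F z (k + 2)) : γ (z i) u = 0 := by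
  have hle : (partAlg F z (k + 2)).toSubmodule ≤ LinearMap.ker (γ (z i)) := by
    refine (h.partAlg_succ_le hk).trans (sup_le (fun u hu => ?_) ?_)
    · exact partAlg_induction (LinearMap.ker (γ (z i))) (fun j _ => hpair i j)
        (fun j hj v _ => LinearMap.mem_ker.2 (hγ.apply_eq_zero_of_lie_eq_zero (hi j hj) v)) hu
    · rintro _ ⟨p, hp, rfl⟩
      obtain ⟨d, hd⟩ := hγ.apply_wordAlg_of_killed hi hp
      change γ (z i) (p (z (k + 2))) = 0
      rw [hd, hpair, mul_zero]
  exact hle hu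

theorem form_wordAlg_apply_self {k : ℕ} (hk : k ≤ m + 1) {p : Module.End F L}
    (hp : p ∈ wordAlg F z (k + 1)) : γ (z (k + 2)) (p (z (k + 2))) = 0 := by
  cases k with
  | zero =>
    have hle : Submodule.span F ({1, LieAlgebra.ad F L (z 0), LieAlgebra.ad F L (z 1),
        LieAlgebra.ad F L (z 0) * LieAlgebra.ad F L (z 1),
        LieAlgebra.ad F L (z 1) * LieAlgebra.ad F L (z 0)} : Set (Module.End F L)) ≤
        LinearMap.ker ((γ (z 2) : L →ₗ[F] F) ∘ₗ LinearMap.applyₗ (z 2)) := by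
      have hself : ∀ u v : L, γ (z 2) ⁅u, ⁅v, z 2⁆⁆ = 0 := fun u v => by
        rw [← lie_skew v (z 2), lie_neg, map_neg, hγ.apply_lie_lie (h.sq 2), neg_zero]
      rw [Submodule.span_le]
      rintro q (rfl | rfl | rfl | rfl | rfl)
      · exact hpair 2 2
      · exact hγ.apply_lie_self _ _
      · exact hγ.apply_lie_self _ _
      · exact hself _ _
      · exact hself _ _
    exact hle (h.wordAlg_one hp)
  | succ k => exact h.form_wordAlg_apply hγ hpair (by omega) (h.comm_succ (by omega) (by omega)) hp

/-- Below the last letter the first triangle is the only value beyond pairs of generators that can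
obstruct vanishing: later letters commute with all but their predecessor, so `form_partAlg` applies
to them. -/
theorem form_partAlg_partAlg (htri : γ (z 2) ⁅z 0, z 1⁆ = 0) {k : ℕ} (hk : k ≤ m + 2) :
    ∀ u ∈ partAlg F z (k + 1), ∀ v ∈ partAlg F z (k + 1), γ u v = 0 := by
  have key : ∀ k, (∀ j ≤ k, ∀ v ∈ partAlg F z k, γ (z j) v = 0) →
      ∀ u ∈ partAlg F z k, ∀ v ∈ partAlg F z k, γ u v = 0 := by
    intro k hk u hu
    let S : Submodule F L :=
      { carrier := {u | ∀ v ∈ partAlg F z k, γ u v = 0}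
        add_mem' := fun {a b} ha hb v hv => by
          rw [map_add, LinearMap.add_apply, ha v hv, hb v hv, add_zero]
        zero_mem' := fun v _ => by rw [map_zero, LinearMap.zero_apply]
        smul_mem' := fun c a ha v hv => by
          rw [map_smul, LinearMap.smul_apply, ha v hv, smul_zero] }
    refine partAlg_induction S hk (fun j hj a ha v hv => ?_) hu
    rw [hγ.lie_left, ha _ ((partAlg F z k).lie_mem (mem_partAlg hj) hv), neg_zero]
  induction k with
  | zero =>
    refine key 1 fun j hj v hv => ?_
    have hle : Submodule.span F ({z 0, z 1, ⁅z 0, z 1⁆} : Set L) ≤ LinearMap.ker (γ (z j)) := by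
      rw [Submodule.span_le]
      rintro _ (rfl | rfl | rfl)
      · exact hpair _ _
      · exact hpair _ _
      · obtain rfl | rfl : j = 0 ∨ j = 1 := by omega
        · exact hγ.lie_self_right _ _
        · exact hγ.apply_lie_self _ _
    exact hle (h.partAlg_one_le hv)
  | succ k ih =>
    have ih := ih (by omega)
    have htop : ∀ v ∈ partAlg F z (k + 1), γ (z (k + 2)) v = 0 := by
      intro v hv
      cases k with
      | zero =>
        have hle : Submodule.span F ({z 0, z 1, ⁅z 0, z 1⁆} : Set L) ≤
            LinearMap.ker (γ (z 2)) := by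
          rw [Submodule.span_le]
          rintro _ (rfl | rfl | rfl)
          · exact hpair _ _
          · exact hpair _ _
          · exact htri
        exact hle (h.partAlg_one_le hv)
      | succ k =>
        exact h.form_partAlg hγ hpair (by omega) (h.comm_succ (by omega) (by omega)) hv
    refine key (k + 2) fun j hj v hv => ?_
    have hle : (partAlg F z (k + 2)).toSubmodule ≤ LinearMap.ker (γ (z j)) := by
      refine (h.partAlg_succ_le (by omega)).trans (sup_le (fun u hu => ?_) ?_)
      · obtain hj | rfl : j ≤ k + 1 ∨ j = k + 2 := by omega
        · exact ih _ (mem_partAlg hj) u hu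
        · exact htop u hu
      · rintro _ ⟨p, hp, rfl⟩
        change γ (z j) (p (z (k + 2))) = 0
        obtain hj | rfl : j ≤ k + 1 ∨ j = k + 2 := by omega
        -- Moving `p` to the other side makes this a pairing of `z_{k+2}` with an element of the
        -- smaller subalgebra.
        · obtain ⟨q, hq, hpq⟩ := hγ.exists_adjoint hp
          rw [hpq, hγ.symm]
          exact htop _ (wordAlg_apply_mem_partAlg hq (mem_partAlg hj))
        · exact h.form_wordAlg_apply_self hγ hpair (by omega) hp
    exact hle hv

/-- Among `p z_{m+3}`, classified by the letter `z_{m+2}` in `p`, only three values matter: the pair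
of generators, the last triangle and the bounce, which is the long word. -/
theorem form_last_partAlg (htri : γ (z (m + 4)) ⁅z (m + 2), z (m + 3)⁆ = 0)
    (hb : γ (z (m + 4)) (bounce F z (m + 2) (z (m + 3))) = 0) {u : L}
    (hu : u ∈ partAlg F z (m + 3)) : γ (z (m + 4)) u = 0 := by
  have ha := h.comm_last
  have hc := h.comm_prev
  have hle : (partAlg F z (m + 3)).toSubmodule ≤ LinearMap.ker (γ (z (m + 4))) := by
    refine (h.partAlg_succ_le le_rfl).trans (sup_le (fun u hu => ?_) ?_)
    · exact h.form_partAlg hγ hpair (by omega) ha hu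
    · rintro _ ⟨p, hp, rfl⟩
      refine h.mem_of_mem_wordAlg (by omega) (LinearMap.ker
        ((γ (z (m + 4)) : L →ₗ[F] F) ∘ₗ LinearMap.applyₗ (z (m + 3))))
        (fun p hp => ?_) (fun p hp q hq => ?_) hb hp
      · change γ (z (m + 4)) (p (z (m + 3))) = 0
        obtain ⟨d, hd⟩ := hγ.apply_wordAlg_of_killed ha hp
        rw [hd, hpair, mul_zero]
      · change γ (z (m + 4)) (p ⁅z (m + 2), q (z (m + 3))⁆) = 0
        obtain ⟨d, hd⟩ := hγ.apply_wordAlg_of_killed ha hp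
        obtain ⟨e, he⟩ := wordAlg_apply_of_killed hc hq
        rw [hd, he, lie_smul, map_smul, htri, smul_zero, mul_zero]
  exact hle hu

/-- The cases are those of `last_lie_wordAlg_apply`, but under the form all of them vanish: the
words that survived there have the shape excluded by `hN`, directly or after taking adjoints. -/
theorem form_last_wordAlg {p : Module.End F L} (hp : p ∈ wordAlg F z (m + 3)) :
    γ (z (m + 4)) (p (z (m + 4))) = 0 := by
  have ha := h.comm_last
  have hb := h.comm_prev
  have hN := hγ.apply_lie_lie_lie (h.sand (m + 4))
  have hself : ∀ y w : L, γ (z (m + 4)) ⁅y, ⁅w, z (m + 4)⁆⁆ = 0 := fun y w => by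
    rw [← lie_skew w, lie_neg, map_neg, hγ.apply_lie_lie (h.sq _), neg_zero]
  refine h.mem_of_mem_wordAlg le_rfl (LinearMap.ker
    ((γ (z (m + 4)) : L →ₗ[F] F) ∘ₗ LinearMap.applyₗ (z (m + 4))))
    (fun p hp => ?_) (fun p hp q hq => ?_) ?_ hp
  · exact h.form_wordAlg_apply hγ hpair (by omega) ha hp
  · change γ (z (m + 4)) (p ⁅z (m + 3), q (z (m + 4))⁆) = 0
    refine h.wordAlg_apply_last (LinearMap.ker ((γ (z (m + 4)) : L →ₗ[F] F) ∘ₗ p ∘ₗ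
        (LieAlgebra.ad F L (z (m + 3)) : L →ₗ[F] L))) ?_ (fun r hr => ?_) ?_ hq
    · change γ (z (m + 4)) (p ⁅z (m + 3), z (m + 4)⁆) = 0
      refine h.mem_of_mem_wordAlg (by omega) (LinearMap.ker
        ((γ (z (m + 4)) : L →ₗ[F] F) ∘ₗ LinearMap.applyₗ ⁅z (m + 3), z (m + 4)⁆))
        (fun p hp => ?_) (fun p hp q hq => ?_) ?_ hp
      · change γ (z (m + 4)) (p ⁅z (m + 3), z (m + 4)⁆) = 0
        obtain ⟨d, hd⟩ := hγ.apply_wordAlg_of_killed ha hp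
        rw [hd, hγ.apply_lie_self, mul_zero]
      · change γ (z (m + 4)) (p ⁅z (m + 2), q ⁅z (m + 3), z (m + 4)⁆⁆) = 0
        obtain ⟨d, hd⟩ := hγ.apply_wordAlg_of_killed ha hp
        obtain ⟨c, hc⟩ := wordAlg_apply_of_killed (fun j hj => h.lie_lie_eq_zero_of_le hj) hq
        rw [hd, hc, lie_smul, map_smul, hself, smul_zero, mul_zero]
      · change γ (z (m + 4)) (bounce F z (m + 2) ⁅z (m + 3), z (m + 4)⁆) = 0
        -- Moving the whole bounce and `z_{m+3}` to the left argument reverses the word; it becomes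
        -- `z_{m+3} z_{m+2} z_{m+4} ⋯` paired with `z_{m+4}`.
        obtain ⟨s, hs, hsγ⟩ := hγ.exists_adjoint (bounce_mem_wordAlg (F := F) (z := z) (m + 1))
        rw [bounce_apply, hγ.assoc, hsγ, hγ.assoc, hγ.assoc, hγ.symm,
          wordAlg_apply_lie ha hs, ← lie_skew ⁅⁅z (m + 4), s (z (m + 2))⁆, z (m + 2)⁆ (z (m + 3)),
          ← lie_skew ⁅z (m + 4), s (z (m + 2))⁆ (z (m + 2)), lie_neg, neg_neg, hN]
    · change γ (z (m + 4)) (p ⁅z (m + 3), r ⁅z (m + 2), z (m + 4)⁆⁆) = 0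
      rw [← wordAlg_apply_lie hb hr]
      refine h.mem_of_mem_wordAlg (by omega) (LinearMap.ker
        ((γ (z (m + 4)) : L →ₗ[F] F) ∘ₗ
          LinearMap.applyₗ (r ⁅z (m + 3), ⁅z (m + 2), z (m + 4)⁆⁆)))
        (fun p hp => ?_) (fun p hp q hq => ?_) ?_ hp
      · change γ (z (m + 4)) (p (r ⁅z (m + 3), ⁅z (m + 2), z (m + 4)⁆⁆)) = 0
        obtain ⟨d, hd⟩ := hγ.apply_wordAlg_of_killed ha hp
        obtain ⟨e, he⟩ := hγ.apply_wordAlg_of_killed ha hr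
        rw [hd, he, hself, mul_zero, mul_zero]
      · change γ (z (m + 4)) (p ⁅z (m + 2), (q * r) ⁅z (m + 3), ⁅z (m + 2), z (m + 4)⁆⁆⁆) = 0
        have hqr := Subalgebra.mul_mem _ hq hr
        obtain ⟨d, hd⟩ := hγ.apply_wordAlg_of_killed ha hp
        rw [hd, ← lie_skew (z (m + 2)) (z (m + 4)), lie_neg, map_neg, wordAlg_apply_lie hb hqr,
          wordAlg_apply_lie ha hqr, lie_neg, map_neg, hN, neg_zero, mul_zero]
      · change γ (z (m + 4)) (bounce F z (m + 2) (r ⁅z (m + 3), ⁅z (m + 2), z (m + 4)⁆⁆)) = 0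
        obtain ⟨c, hc⟩ := h.bounce_mul (k := m) (by omega) (wordAlg_mono (by omega) hr)
        have := LinearMap.congr_fun hc ⁅z (m + 3), ⁅z (m + 2), z (m + 4)⁆⁆
        rw [Module.End.mul_apply, LinearMap.smul_apply, h.bounce_lie_lie, smul_zero] at this
        rw [this, map_zero]
    · change γ (z (m + 4)) (p ⁅z (m + 3), bounce F z (m + 2) (z (m + 4))⁆) = 0
      refine h.mem_of_mem_wordAlg (by omega) (LinearMap.ker
        ((γ (z (m + 4)) : L →ₗ[F] F) ∘ₗ
          LinearMap.applyₗ ⁅z (m + 3), bounce F z (m + 2) (z (m + 4))⁆))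
        (fun p hp => ?_) (fun p hp q hq => ?_) ?_ hp
      · change γ (z (m + 4)) (p ⁅z (m + 3), bounce F z (m + 2) (z (m + 4))⁆) = 0
        obtain ⟨d, hd⟩ := hγ.apply_wordAlg_of_killed ha hp
        rw [hd, bounce_apply, ← lie_skew (z (m + 2)) (z (m + 4)), map_neg, bounce_apply_lie ha,
          lie_neg, lie_neg, map_neg, hN, neg_zero, mul_zero]
      · change γ (z (m + 4)) (p ⁅z (m + 2), q ⁅z (m + 3), bounce F z (m + 2) (z (m + 4))⁆⁆) = 0
        obtain ⟨c, hc⟩ := h.mul_bounce (k := m) (by omega) (wordAlg_mono (by omega) hq)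
        have := LinearMap.congr_fun hc (z (m + 4))
        rw [Module.End.mul_apply, LinearMap.smul_apply] at this
        rw [wordAlg_apply_lie hb hq, this, lie_smul, lie_smul, h.lie_bounce_lie, smul_zero,
          map_zero, map_zero]
      · change γ (z (m + 4)) (bounce F z (m + 2) ⁅z (m + 3), bounce F z (m + 2) (z (m + 4))⁆) = 0
        rw [h.bounce_lie_bounce, map_zero]
  · change γ (z (m + 4)) (bounce F z (m + 3) (z (m + 4))) = 0
    rw [bounce_apply, bounce_apply, leibniz_lie (z (m + 2)) (z (m + 3)), map_add, lie_add, lie_add,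
      map_add, bounce_apply_lie hb, h.sand, map_zero, add_zero,
      ← lie_skew ⁅z (m + 2), z (m + 3)⁆, map_neg, bounce_apply_lie ha, lie_neg, lie_neg, map_neg,
      hN, neg_zero]

/-- An invariant form on a sandwich algebra of this kind is determined by its values on pairs of
generators, the two triangles, and one long word. -/
theorem form_eq_zero (htri : γ (z 2) ⁅z 0, z 1⁆ = 0)
    (htri' : γ (z (m + 4)) ⁅z (m + 2), z (m + 3)⁆ = 0)
    (hb : γ (z (m + 4)) (bounce F z (m + 2) (z (m + 3))) = 0) : γ = 0 := by
  have hpart : ∀ u ∈ partAlg F z (m + 3), γ (z (m + 4)) u = 0 := fun u hu =>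
    h.form_last_partAlg hγ hpair htri' hb hu
  have hlast : (⊤ : Submodule F L) ≤ LinearMap.ker (γ (z (m + 4))) := by
    rw [← h.sup_eq_top]
    refine sup_le (sup_le hpart ?_) ?_
    · rintro _ ⟨p, hp, rfl⟩
      exact h.form_last_wordAlg hγ hpair hp
    · rw [tailSpan, Submodule.span_le]
      rintro _ (rfl | rfl)
      · exact hγ.lie_self_right _ _
      · exact hγ.lie_self_right _ _
  have hlast' : ∀ u, γ (z (m + 4)) u = 0 := fun u => hlast Submodule.mem_top
  refine hγ.eq_zero h.lieSpan_eq ?_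
  rintro _ ⟨j, hj, rfl⟩ y
  rw [Set.mem_Iic] at hj
  have hle : (⊤ : Submodule F L) ≤ LinearMap.ker (γ (z j)) := by
    obtain hj | rfl : j ≤ m + 3 ∨ j = m + 4 := by omega
    · rw [← h.sup_eq_top]
      refine sup_le (sup_le (fun u hu => ?_) ?_) ?_
      · exact h.form_partAlg_partAlg hγ hpair htri le_rfl _ (mem_partAlg hj) u hu
      · rintro _ ⟨p, hp, rfl⟩
        change γ (z j) (p (z (m + 4))) = 0
        obtain ⟨q, hq, hpq⟩ := hγ.exists_adjoint hp
        rw [hpq, hγ.symm, hlast']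
      -- Both spanning elements of the tail begin with `z_{m+4}`, and invariance moves everything
      -- else away from it.
      · have hzero : ∀ w, γ (z j) ⁅z (m + 4), w⁆ = 0 := fun w => by
          rw [hγ.lie_right, ← hγ.assoc, hlast', neg_zero]
        rw [tailSpan, Submodule.span_le]
        rintro _ (rfl | rfl)
        · exact hzero _
        · exact hzero _
    · exact hlast
  exact hle Submodule.mem_top

end IsSandwichFamily

end Forms

/-! ### Application to the four graphs -/

section Words

variable {F : Type*} [Field F]

theorem mono_cons {V : Type*} (Γ : SimpleGraph V) (i : V) {w : List V} (hw : w ≠ []) :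
    mono F Γ (i :: w) = ⁅gen F Γ i, mono F Γ w⁆ := by
  cases w with
  | nil => exact absurd rfl hw
  | cons j w => rfl

theorem projHom_mono_append {V : Type*} {Γ : SimpleGraph V} (f : Functionals F Γ) (w : List V)
    (i : V) :
    projHom f (mono F Γ (w ++ [i]))
      = (w.map fun j => LieAlgebra.ad F _ (projHom f (gen F Γ j))).prod
          (projHom f (gen F Γ i)) := by
  induction w with
  | nil => rfl
  | cons j w ih =>
    rw [List.cons_append, mono_cons Γ j (by simp), LieHom.map_lie, ih]
    simp

variable {L : Type*} [LieRing L] [LieAlgebra F L]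

/-- The labels climb to `n - 2` with `n = m + 5`, jump to `n` and descend; in the reversed numbering
each further outer pair of letters is one recursion step of `bounce`. The jump accounts for the
central product `z_0 z_1`. -/
theorem prod_map_up_append_down (x : ℕ → L) (m : ℕ) {j : ℕ} (hj : j ≤ m + 3) :
    ((up (m + 4 - j) (m + 3) ++ down (m + 5) (m + 4 - j)).map fun l =>
      LieAlgebra.ad F L (x l)).prod = bounce F (fun j => x (m + 5 - j)) (j + 1) := by
  induction j with
  | zero =>
    have h2 : m + 5 + 1 - (m + 4) = 2 := by omega
    simp [up, down, h2, bounce, List.range'_succ]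
  | succ j ih =>
    have h1 : m + 3 + 1 - (m + 4 - (j + 1)) = (m + 3 + 1 - (m + 4 - j)) + 1 := by omega
    have h2 : m + 5 + 1 - (m + 4 - (j + 1)) = (m + 5 + 1 - (m + 4 - j)) + 1 := by omega
    have h3 : m + 4 - (j + 1) + 1 = m + 4 - j := by omega
    have h4 : m + 5 - (j + 2) = m + 4 - (j + 1) := by omega
    have e1 : up (m + 4 - (j + 1)) (m + 3) = (m + 4 - (j + 1)) :: up (m + 4 - j) (m + 3) := by
      rw [up, h1, List.range'_succ, h3]; rfl
    have e2 : down (m + 5) (m + 4 - (j + 1)) = down (m + 5) (m + 4 - j) ++ [m + 4 - (j + 1)] := by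
      rw [down, up, h2, List.range'_succ, h3, List.reverse_cons]; rfl
    rw [e1, e2, bounce, ← ih (by omega), h4]
    simp only [List.cons_append, List.map_cons, List.map_append, List.prod_cons, List.prod_append,
      List.map_nil, List.prod_nil, mul_one, mul_assoc]

/-- For paths without a triangle at the far end, `z_0` is a padding zero and the long word drops
out. -/
theorem bounce_eq_zero {z : ℕ → L} (h0 : z 0 = 0) (k : ℕ) : bounce F z (k + 1) = 0 := by
  induction k with
  | zero => rw [bounce, h0, map_zero, zero_mul]
  | succ k ih => rw [bounce, ih, mul_zero, zero_mul]

end Words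

/-! ### From graphs on labels to sandwich families -/

section Glue

variable {F : Type*} [Field F] {n : ℕ} [NeZero n] {Γ : SimpleGraph (Fin n)}

theorem vert_val {k : ℕ} (h1 : 1 ≤ k) (hk : k ≤ n) : (vert n k : ℕ) = k - 1 := by
  rw [vert, Fin.val_ofNat, Nat.mod_eq_of_lt (by omega)]

theorem vert_succ (i : Fin n) : vert n (i + 1) = i := by
  ext
  rw [vert_val (by omega) (by omega)]; omega

theorem val_eq (f : Functionals F Γ) (k : ℕ) (w : List ℕ) :
    val f k w = f (vert n k) (mono F Γ (w.map (vert n))) :=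
  rfl

variable (F Γ) in
/-- The generator with label `k`, for `f = 0`; it is `0` for labels out of range. -/
def genAt (k : ℕ) : ExtLie (0 : Functionals F Γ) :=
  if 1 ≤ k ∧ k ≤ n then projHom 0 (gen F Γ (vert n k)) else 0

theorem genAt_of_le {k : ℕ} (h1 : 1 ≤ k) (hk : k ≤ n) :
    genAt F Γ k = projHom 0 (gen F Γ (vert n k)) :=
  if_pos ⟨h1, hk⟩

theorem genAt_of_lt {k : ℕ} (hk : n < k) : genAt F Γ k = 0 :=
  if_neg (by omega)

theorem genAt_sq (k : ℕ) (y : ExtLie (0 : Functionals F Γ)) :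
    ⁅genAt F Γ k, ⁅genAt F Γ k, y⁆⁆ = 0 := by
  rw [genAt]
  split_ifs
  · obtain ⟨y, rfl⟩ := projHom_surjective _ y
    rw [projHom_gen_lie_lie]
    simp
  · simp

/-- All edges join consecutive labels, or the labels `1` and `3`, or, if `n = m + 5`, the labels
`n - 2` and `n`. -/
def IsPathLike (m : ℕ) (Γ : SimpleGraph (Fin n)) : Prop :=
  ∀ i j : Fin n, Γ.Adj i j → i.1 < j.1 →
    j.1 = i.1 + 1 ∨ (i.1 = 0 ∧ j.1 = 2) ∨ (n = m + 5 ∧ i.1 + 3 = n ∧ j.1 + 1 = n)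

theorem IsPathLike.isSandwichFamily (h2 : (2 : F) ≠ 0) {m : ℕ} (hnm : n ≤ m + 5)
    (hΓ : IsPathLike m Γ) : IsSandwichFamily F m fun j => genAt F Γ (m + 5 - j) where
  lieSpan_eq := by
    rw [eq_top_iff, ← lieSpan_range_proj_gen (0 : Functionals F Γ)]
    refine LieSubalgebra.lieSpan_mono ?_
    rintro _ ⟨i, rfl⟩
    -- The vertex `i`, counted from 0, has label `i + 1` and so index `m + 5 - (i + 1)`.
    refine ⟨m + 4 - i, by simp, ?_⟩
    have : m + 5 - (m + 4 - (i : ℕ)) = i + 1 := by omega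
    simp only [this]
    rw [genAt_of_le (by omega) (by omega), vert_succ]
  sq j y := genAt_sq _ y
  sand j y u := lie_lie_lie_eq_zero h2 (genAt_sq _) y u
  comm i j h1 h3 h4 := by
    by_cases hi : m + 5 - i ≤ n ∧ 1 ≤ m + 5 - j
    · rw [genAt_of_le (by omega) hi.1, genAt_of_le hi.2 (by omega), ← LieHom.map_lie, gen_lie_gen,
        map_zero]
      intro hadj
      have := hΓ _ _ hadj.symm
      rw [vert_val (by omega) (by omega), vert_val (by omega) (by omega)] at this
      have := this (by omega)
      omega
    · by_cases h : m + 5 - i ≤ n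
      · have h0 : genAt F Γ (m + 5 - j) = 0 := if_neg (by omega)
        rw [h0, lie_zero]
      · rw [genAt_of_lt (by omega), zero_lie]

theorem IsPathLike.finite (h2 : (2 : F) ≠ 0) {m : ℕ} (hnm : n ≤ m + 5)
    (hΓ : IsPathLike m Γ) : Module.Finite F (ExtLie (0 : Functionals F Γ)) :=
  (hΓ.isSandwichFamily h2 hnm).finite

theorem projHom_mono_long {m : ℕ} (hnm : n = m + 5) :
    projHom (0 : Functionals F Γ) (mono F Γ ((up 3 (n - 2) ++ down n 2).map (vert n)))
      = bounce F (fun j => genAt F Γ (m + 5 - j)) (m + 2) (genAt F Γ 2) := by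
  subst hnm
  have e : down (m + 5) 2 = down (m + 5) 3 ++ [2] := by
    have : m + 5 + 1 - 2 = (m + 5 + 1 - 3) + 1 := by omega
    rw [down, up, this, List.range'_succ, List.reverse_cons]; rfl
  have h := prod_map_up_append_down (F := F) (genAt F Γ) m (j := m + 1) (by omega)
  have h3 : m + 4 - (m + 1) = 3 := by omega
  have h4 : m + 5 - 2 = m + 3 := by omega
  rw [h3] at h
  rw [← h, h4, e, ← List.append_assoc, List.map_append, List.map_singleton, projHom_mono_append,
    List.map_map, genAt_of_le (by omega) (by omega)]
  congr 2
  refine List.map_congr_left fun l hl => ?_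
  have : 1 ≤ l ∧ l ≤ m + 5 := by
    simp only [up, down, List.mem_append, List.mem_reverse, List.mem_range'_1] at hl
    omega
  rw [Function.comp_apply, genAt_of_le this.1 this.2]

/-- The values that determine a point of the parameter space. -/
theorem IsPathLike.functionals_eq (h2 : (2 : F) ≠ 0) {m : ℕ} (hnm : n ≤ m + 5)
    (hΓ : IsPathLike m Γ) {f f' : Functionals F Γ} (hf : f ∈ ParamSpace F Γ)
    (hf' : f' ∈ ParamSpace F Γ)
    (hpath : ∀ k, 1 ≤ k → k + 1 ≤ n → val f k [k + 1] = val f' k [k + 1])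
    (h13 : 3 ≤ n → val f 1 [3] = val f' 1 [3])
    (h123 : 3 ≤ n → val f 1 [2, 3] = val f' 1 [2, 3])
    (hn : n = m + 5 → val f (n - 2) [n] = val f' (n - 2) [n])
    (hnn : n = m + 5 → val f (n - 2) [n - 1, n] = val f' (n - 2) [n - 1, n])
    (hw : n = m + 5 → val f 1 (up 3 (n - 2) ++ down n 2) = val f' 1 (up 3 (n - 2) ++ down n 2)) :
    f = f' := by
  have hS := hΓ.isSandwichFamily h2 hnm
  have := hS.finite
  -- The extra words are the two triangles and the long word. Those at the far end are listed only
  -- if `n = m + 5`; otherwise `z_0 = 0` and the corresponding values vanish.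
  refine ExtremalLie.functionals_eq h2
    {p : Fin n × List (Fin n) | (3 ≤ n ∧ p = (vert n 1, [2, 3].map (vert n))) ∨
      (n = m + 5 ∧ p = (vert n (n - 2), [n - 1, n].map (vert n))) ∨
      (n = m + 5 ∧ p = (vert n 1, (up 3 (n - 2) ++ down n 2).map (vert n)))}
    (fun γ hγ hpair hT => ?_) hf hf'
    (fun i j => j.1 = i.1 + 1 ∨ (i.1 = 0 ∧ j.1 = 2) ∨ (n = m + 5 ∧ i.1 + 3 = n ∧ j.1 + 1 = n))
    (fun i j hij => ?_) (fun i j hij => ?_) ?_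
  · have hp : ∀ k l, γ (genAt F Γ k) (genAt F Γ l) = 0 := by
      intro k l
      rw [genAt, genAt]
      split_ifs
      · exact hpair _ _
      all_goals simp
    have e1 : m + 5 - (m + 4) = 1 := by omega
    have e2 : m + 5 - (m + 3) = 2 := by omega
    have e3 : m + 5 - (m + 2) = 3 := by omega
    refine hS.form_eq_zero hγ (fun i j => hp _ _) ?_ ?_ ?_
    · change γ (genAt F Γ (m + 3)) ⁅genAt F Γ (m + 5), genAt F Γ (m + 4)⁆ = 0
      by_cases hn5 : n = m + 5
      · have h := hT _ (Or.inr (Or.inl ⟨hn5, rfl⟩))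
        have e4 : n - 2 = m + 3 := by omega
        have e5 : n - 1 = m + 4 := by omega
        simp only [List.map_cons, List.map_nil, mono, LieHom.map_lie] at h
        rw [← genAt_of_le (by omega) (by omega), ← genAt_of_le (by omega) (by omega),
          ← genAt_of_le (by omega) (by omega), e4, e5] at h
        rw [← lie_skew, map_neg, neg_eq_zero, ← hn5]
        exact h
      · rw [genAt_of_lt (k := m + 5) (by omega), zero_lie, map_zero]
    · simp only [e1, e2, e3]
      by_cases hn3 : 3 ≤ n
      · have h := hT _ (Or.inl ⟨hn3, rfl⟩)
        simp only [List.map_cons, List.map_nil, mono, LieHom.map_lie] at h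
        rw [← genAt_of_le (by omega) (by omega), ← genAt_of_le (by omega) (by omega),
          ← genAt_of_le (by omega) (by omega)] at h
        rw [← lie_skew, map_neg, neg_eq_zero]
        exact h
      · rw [genAt_of_lt (k := 3) (by omega), zero_lie, map_zero]
    · simp only [e1, e2]
      by_cases hn5 : n = m + 5
      · have h := hT _ (Or.inr (Or.inr ⟨hn5, rfl⟩))
        rw [projHom_mono_long hn5, ← genAt_of_le (by omega) (by omega)] at h
        exact h
      · rw [bounce_eq_zero (z := fun j => genAt F Γ (m + 5 - j)) (genAt_of_lt (by omega)), LinearMap.zero_apply, map_zero]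
  · have hne : i.1 ≠ j.1 := fun h => hij.ne (Fin.ext h)
    rcases Nat.lt_or_gt_of_ne hne with h | h
    · exact Or.inl (hΓ i j hij h)
    · exact Or.inr (hΓ j i hij.symm h)
  · have key : ∀ k l, val f k [l] = val f' k [l] → i = vert n k → j = vert n l →
        f i (gen F Γ j) = f' i (gen F Γ j) := by
      rintro k l h rfl rfl; exact h
    rcases hij with h | ⟨h1, h3⟩ | ⟨h0, h1, h3⟩
    · refine key (i + 1) (i + 1 + 1) (hpath _ (by omega) (by omega)) (vert_succ i).symm ?_
      rw [← h, vert_succ]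
    · refine key 1 3 (h13 (by omega)) ?_ ?_
      · rw [← vert_succ i, h1]
      · rw [← vert_succ j, h3]
    · refine key (n - 2) n (hn h0) ?_ ?_
      · rw [← vert_succ i]; congr 1; omega
      · rw [← vert_succ j, h3]
  · rintro p (⟨h, rfl⟩ | ⟨h, rfl⟩ | ⟨h, rfl⟩)
    · exact h123 h
    · exact hnn h
    · exact hw h

omit [NeZero n] in
theorem isPathLike_graphC (m : ℕ) : IsPathLike m (graphC n) := by
  intro i j hij hlt
  simp only [graphC, SimpleGraph.fromRel_adj, label] at hij
  omega

omit [NeZero n] in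
theorem isPathLike_graphA (m : ℕ) : IsPathLike m (graphA n) := by
  intro i j hij hlt
  simp only [graphA, SimpleGraph.fromRel_adj, label] at hij
  omega

omit [NeZero n] in
theorem isPathLike_graphB {m : ℕ} (hm : n = m + 5) : IsPathLike m (graphB n) := by
  intro i j hij hlt
  simp only [graphB, SimpleGraph.fromRel_adj, label] at hij
  omega

omit [NeZero n] in
theorem isPathLike_graphD {m : ℕ} (hm : n = m + 5) : IsPathLike m (graphD n) := by
  intro i j hij hlt
  simp only [graphD, SimpleGraph.fromRel_adj, label] at hij
  omega

theorem val_singleton_eq_zero {f : Functionals F Γ} {k l : ℕ}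
    (hf : projHom f (gen F Γ (vert n k)) ≠ 0) (h : ¬ Γ.Adj (vert n k) (vert n l)) :
    val f k [l] = 0 :=
  functional_eq_zero_of_not_adj hf h

/-- As `x_i` and `x_k` commute, `(ad x_i)²[x_j, x_k] = [(ad x_i)² x_j, x_k]`, a multiple of `[x_i,
x_k] = 0`. -/
theorem functional_lie_eq_zero_of_not_adj {V : Type*} {Γ : SimpleGraph V} {f : Functionals F Γ}
    {i j k : V} (hf : projHom f (gen F Γ i) ≠ 0) (h : ¬ Γ.Adj i k) :
    f i ⁅gen F Γ j, gen F Γ k⁆ = 0 := by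
  have h1 := projHom_gen_lie_lie f i ⁅gen F Γ j, gen F Γ k⁆
  have h2 : ⁅projHom f (gen F Γ i), projHom f (gen F Γ k)⁆ = 0 := by
    rw [← LieHom.map_lie, gen_lie_gen h, map_zero]
  rw [LieHom.map_lie, leibniz_lie (projHom f (gen F Γ i)) (projHom f (gen F Γ j)), h2, lie_zero,
    add_zero, leibniz_lie, h2, lie_zero, add_zero, projHom_gen_lie_lie, smul_lie, h2,
    smul_zero] at h1
  exact (smul_eq_zero.1 h1.symm).resolve_right hf

theorem psiC_injective (h2 : (2 : F) ≠ 0) : Function.Injective (psiC (F := F) (n := n)) := by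
  -- With `m = n - 1` one has `n < m + 5`, so every condition at the far end is vacuous, even for
  -- small `n`.
  have hΓ := isPathLike_graphC (n := n) (n - 1)
  have := hΓ.finite (F := F) h2 (by omega)
  intro f f' h
  have hadj : 3 ≤ n → ¬ (graphC n).Adj (vert n 1) (vert n 3) := by
    intro h3 hadj
    simp only [graphC, SimpleGraph.fromRel_adj, label] at hadj
    rw [vert_val (by omega) (by omega), vert_val (by omega) (by omega)] at hadj
    omega
  refine Subtype.ext (hΓ.functionals_eq h2 (by omega) f.2 f'.2 (fun k h1 hk => ?_) (fun h3 => ?_)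
    (fun h3 => ?_) (by omega) (by omega) (by omega))
  · have := congr_fun h ⟨k - 1, by omega⟩
    have e : k - 1 + 1 = k := by omega
    have e' : k - 1 + 2 = k + 1 := by omega
    simpa only [psiC, e, e'] using this
  · rw [val_singleton_eq_zero (projHom_gen_ne_zero f.2 _) (hadj h3),
      val_singleton_eq_zero (projHom_gen_ne_zero f'.2 _) (hadj h3)]
  · exact (functional_lie_eq_zero_of_not_adj (projHom_gen_ne_zero f.2 _) (hadj h3)).trans
      (functional_lie_eq_zero_of_not_adj (projHom_gen_ne_zero f'.2 _) (hadj h3)).symm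

theorem append_comp_cast_eq {α : Type*} {a b c : ℕ} {u u' : Fin a → α} {v v' : Fin b → α}
    {hc : c = a + b}
    (h : Fin.append u v ∘ Fin.cast hc = Fin.append u' v' ∘ Fin.cast hc) : u = u' ∧ v = v' := by
  subst hc
  simp only [Fin.cast_refl, Function.comp_id] at h
  constructor
  · funext i
    simpa using congr_fun h (Fin.castAdd b i)
  · funext i
    simpa using congr_fun h (Fin.natAdd a i)

theorem psiA_injective (h2 : (2 : F) ≠ 0) (hn : 3 ≤ n) :
    Function.Injective (psiA (F := F) hn) := by
  intro f f' h
  obtain ⟨hu, hv⟩ := append_comp_cast_eq h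
  -- Here `m + 5 = n + 2`, so the far triangle is padded by zeros.
  refine Subtype.ext ((isPathLike_graphA (n - 3)).functionals_eq h2 (by omega) f.2 f'.2
    (fun k h1 hk => ?_) (fun _ => congr_fun hv 0) (fun _ => congr_fun hv 1) (by omega) (by omega)
    (by omega))
  have := congr_fun hu ⟨k - 1, by omega⟩
  have e : k - 1 + 1 = k := by omega
  have e' : k - 1 + 2 = k + 1 := by omega
  simpa only [e, e'] using this

theorem psiB_injective (h2 : (2 : F) ≠ 0) (hn : 5 ≤ n) :
    Function.Injective (psiB (F := F) hn) := by
  have hΓ := isPathLike_graphB (n := n) (m := n - 5) (by omega)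
  have := hΓ.finite (F := F) h2 (by omega)
  intro f f' h
  obtain ⟨hu, hv⟩ := append_comp_cast_eq h
  -- Without the edge `{n-1, n}` the values `f_{n-1}(x_n)` and `f_{n-2}(x_{n-1} x_n)` vanish, so
  -- they need no coordinates.
  have hadj : ¬ (graphB n).Adj (vert n (n - 1)) (vert n n) := by
    intro hadj
    simp only [graphB, SimpleGraph.fromRel_adj, label] at hadj
    rw [vert_val (by omega) (by omega), vert_val (by omega) (by omega)] at hadj
    omega
  refine Subtype.ext (hΓ.functionals_eq h2 (by omega) f.2 f'.2
    (fun k h1 hk => ?_) (fun _ => congr_fun hv 0) (fun _ => congr_fun hv 1)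
    (fun _ => congr_fun hv 2) (fun _ => ?_) (fun _ => congr_fun hv 3))
  · by_cases hkn : k = n - 1
    · have e : k + 1 = n := by omega
      rw [e, hkn, val_singleton_eq_zero (projHom_gen_ne_zero f.2 _) hadj,
        val_singleton_eq_zero (projHom_gen_ne_zero f'.2 _) hadj]
    · have := congr_fun hu ⟨k - 1, by omega⟩
      have e : k - 1 + 1 = k := by omega
      have e' : k - 1 + 2 = k + 1 := by omega
      simpa only [e, e'] using this
  · simp only [val_eq, List.map_cons, List.map_nil, mono, gen_lie_gen hadj, map_zero]

theorem psiD_injective (h2 : (2 : F) ≠ 0) (hn : 5 ≤ n) :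
    Function.Injective (psiD (F := F) hn) := by
  intro f f' h
  obtain ⟨hu, hv⟩ := append_comp_cast_eq h
  refine Subtype.ext ((isPathLike_graphD (m := n - 5) (by omega)).functionals_eq h2 (by omega)
    f.2 f'.2 (fun k h1 hk => ?_) (fun _ => congr_fun hv 0) (fun _ => congr_fun hv 1)
    (fun _ => congr_fun hv 2) (fun _ => congr_fun hv 3) (fun _ => congr_fun hv 4))
  have := congr_fun hu ⟨k - 1, by omega⟩
  have e : k - 1 + 1 = k := by omega
  have e' : k - 1 + 2 = k + 1 := by omega
  simpa only [e, e'] using this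

end Glue

end ExtremalLie
end

theorem mainTheorem11 {F : Type*} [Field F] [IsAlgClosed F] (h2 : (2 : F) ≠ 0)
    (n : ℕ) [NeZero n] :
    (∀ hn : 5 ≤ n,
      Function.Injective (ExtremalLie.psiD (F := F) hn) ∧
        ExtremalLie.DeterminesForm (ExtremalLie.psiD (F := F) hn)) ∧
    (∀ hn : 5 ≤ n,
      Function.Injective (ExtremalLie.psiB (F := F) hn) ∧
        ExtremalLie.DeterminesForm (ExtremalLie.psiB (F := F) hn)) ∧
    (∀ hn : 3 ≤ n,
      Function.Injective (ExtremalLie.psiA (F := F) hn) ∧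
        ExtremalLie.DeterminesForm (ExtremalLie.psiA (F := F) hn)) ∧
    (Function.Injective (ExtremalLie.psiC (F := F) (n := n)) ∧
      ExtremalLie.DeterminesForm (ExtremalLie.psiC (F := F) (n := n))) := by
  refine ⟨fun hn => ?_, fun hn => ?_, fun hn => ?_, ?_⟩
  · have := (ExtremalLie.isPathLike_graphD (n := n) (m := n - 5) (by omega)).finite (F := F) h2
      (by omega)
    have h := ExtremalLie.psiD_injective (F := F) h2 hn
    exact ⟨h, ExtremalLie.determinesForm_of_injective h⟩
  · have := (ExtremalLie.isPathLike_graphB (n := n) (m := n - 5) (by omega)).finite (F := F) h2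
      (by omega)
    have h := ExtremalLie.psiB_injective (F := F) h2 hn
    exact ⟨h, ExtremalLie.determinesForm_of_injective h⟩
  · have := (ExtremalLie.isPathLike_graphA (n := n) (n - 3)).finite (F := F) h2 (by omega)
    have h := ExtremalLie.psiA_injective (F := F) h2 hn
    exact ⟨h, ExtremalLie.determinesForm_of_injective h⟩
  · have := (ExtremalLie.isPathLike_graphC (n := n) (n - 1)).finite (F := F) h2 (by omega)
    have h := ExtremalLie.psiC_injective (F := F) (n := n) h2
    exact ⟨h, ExtremalLie.determinesForm_of_injective h⟩
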